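/- Let $d\ge 1$, let $\mu\in\mathbb R^d$ be nonzero and $\Sigma\in\mathbb R^{d\times d}$ positive definite with $\lVert\mu\rVert^2=\lVert\Sigma\rVert$ (spectral norm). For $\kappa\in(0,\infty)$ let $\mathcal D_\kappa$ be the law of $(x,y)$ where $y$ is uniform on $\{0,1\}$, $x\mid y=1\sim N(\mu,\kappa^{-1}\Sigma)$ and $x\mid y=0\sim N(-\mu,\kappa^{-1}\Sigma)$. Let $\Lambda$ be a probability distribution on $[0,1]$ and $g:[0,1]\to[0,1]$ a measurable function such that $g(z)>\frac12$ if and only if $z>\frac12$, and $\mathbb P_{\lambda\sim\Lambda}[\lambda\notin\{0,1\}\wedge g(\lambda)\ne\frac12]>0$. With $l(z)=\log(1+e^{-z})$, the Mixup loss of a training set $S=\{(x_i,y_i)\}_{i=1}^n$ is $$\mathcal L_S^{\mathrm{mix}}(w)=\frac1{n^2}\sum_{i,j=1}^n \tilde y_{i,j}\,l(w^\top\tilde x_{i,j})+(1-\tilde y_{i,j})\,l(-w^\top\tilde x_{i,j}),$$ where $\tilde x_{i,j}=g(\lambda_{i,j})x_i+(1-g(\lambda_{i,j}))x_j$, $\tilde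 y_{i,j}=\lambda_{i,j}y_i+(1-\lambda_{i,j})y_j$, and the $\lambda_{i,j}$ are i.i.d. from $\Lambda$ and independent of $S$. Then there are constants $K,\kappa_0>0$, depending only on $d,\mu,\Sigma,\Lambda,g$, such that for all $\kappa\ge\kappa_0$, all $\epsilon,\delta\in(0,1)$ and all $$n\ \ge\ \frac{K\kappa^2}{\epsilon^4}\Bigl(1+\log\frac1\epsilon+\log\frac1\delta\Bigr),$$ if $S=\{(x_i,y_i)\}_{i=1}^n$ is drawn i.i.d. from $\mathcal D_\kappa$, then with probability at least $1-\delta$ the loss $\mathcal L_S^{\mathrm{mix}}$ has a unique minimizer $\hat w$ on $\mathbb R^d$; moreover $\hat w\neq0$ and its cosine similarity satisfies $\mathrm{sim}(\hat w,\Sigma^{-1}\mu)=\dfrac{\hat w^\top\Sigma^{-1}\mu}{\lVert\hat w\rVert\,\lVert\Sigma^{-1}\mu\rVert}\ge1-\epsilon$. -/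

import Mathlib

open MeasureTheory ProbabilityTheory
open scoped ENNReal unitInterval

noncomputable section

/-- The logistic loss `l(z) = log (1 + exp (-z))`. -/
def logisticLoss (z : ℝ) : ℝ := Real.log (1 + Real.exp (-z))

/-- The loss of the linear model `w` at a data point `x` with (possibly soft) label `y ∈ [0, 1]`:
`y l(wᵀx) + (1 - y) l(-wᵀx)`. -/
def pointLoss {d : ℕ} (w x : EuclideanSpace ℝ (Fin d)) (y : ℝ) : ℝ :=
  y * logisticLoss (inner ℝ w x) + (1 - y) * logisticLoss (-inner ℝ w x)

/-- Cosine similarity of two (nonzero) vectors. -/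
def cosSim {d : ℕ} (u v : EuclideanSpace ℝ (Fin d)) : ℝ :=
  inner ℝ u v / (‖u‖ * ‖v‖)

/-- The data distribution `D_κ`: the label `y` is uniform on `{0, 1}`, and `x` given `y` has law
`N(m, κ⁻¹ C)` if `y = 1` and `N(-m, κ⁻¹ C)` if `y = 0`. -/
def dataLaw {d : ℕ} (m : EuclideanSpace ℝ (Fin d)) (C : Matrix (Fin d) (Fin d) ℝ) (κ : ℝ) :
    Measure (EuclideanSpace ℝ (Fin d) × ℝ) :=
  (2⁻¹ : ℝ≥0∞) • ((multivariateGaussian m (κ⁻¹ • C)).prod (Measure.dirac 1)) +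
    (2⁻¹ : ℝ≥0∞) • ((multivariateGaussian (-m) (κ⁻¹ • C)).prod (Measure.dirac 0))

/-- A realization of all the randomness in the Mixup loss with `n` training points: the training
set `((x_i, y_i))_i` and the mixing coefficients `(λ_{i,j})_{i,j}`. -/
abbrev MixupSample (d n : ℕ) : Type :=
  (Fin n → EuclideanSpace ℝ (Fin d) × ℝ) × (Fin n × Fin n → I)

/-- The joint law of the randomness: the training points are i.i.d. from `D_κ`, the `n²` mixing
coefficients are i.i.d. from `L`, and the two families are independent. -/
def mixupLaw {d : ℕ} (m : EuclideanSpace ℝ (Fin d)) (C : Matrix (Fin d) (Fin d) ℝ) (κ : ℝ)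
    (L : Measure I) (n : ℕ) : Measure (MixupSample d n) :=
  (Measure.pi fun _ : Fin n => dataLaw m C κ).prod (Measure.pi fun _ : Fin n × Fin n => L)

/-- The mixed data point `g(λ_{i,j}) x_i + (1 - g(λ_{i,j})) x_j`. -/
def mixedPoint {d n : ℕ} (g : I → I) (ω : MixupSample d n) (i j : Fin n) :
    EuclideanSpace ℝ (Fin d) :=
  (g (ω.2 (i, j)) : ℝ) • (ω.1 i).1 + (1 - (g (ω.2 (i, j)) : ℝ)) • (ω.1 j).1

/-- The mixed label `λ_{i,j} y_i + (1 - λ_{i,j}) y_j`. -/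
def mixedLabel {d n : ℕ} (ω : MixupSample d n) (i j : Fin n) : ℝ :=
  (ω.2 (i, j) : ℝ) * (ω.1 i).2 + (1 - (ω.2 (i, j) : ℝ)) * (ω.1 j).2

/-- The empirical Mixup loss. -/
def mixupLoss {d n : ℕ} (g : I → I) (ω : MixupSample d n) (w : EuclideanSpace ℝ (Fin d)) : ℝ :=
  1 / (n : ℝ) ^ 2 * ∑ i : Fin n, ∑ j : Fin n, pointLoss w (mixedPoint g ω i j) (mixedLabel ω i j)

/-- `w` is the unique global minimizer of `f`. -/
def IsUniqueMinimizer {E : Type*} (f : E → ℝ) (w : E) : Prop :=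
  (∀ v, f w ≤ f v) ∧ ∀ v, (∀ u, f v ≤ f u) → v = w

end

/-! The empirical loss is compared with its population version at one deterministic point, and
strong convexity near that point does the rest. Write θ = C⁻¹μ and let T be the square root of κ⁻¹C,
so that a data point is ±μ + T G with G standard Gaussian.

Population gradient. If u ⟂ μ, then ⟨Tu, Tθ⟩ = κ⁻¹⟨u, Cθ⟩ = κ⁻¹⟨u, μ⟩ = 0. Hence the reflection of
the noise that negates Tu fixes Tθ: it preserves the law, the labels and every ⟨θ, x⟩, and flips
every ⟨u, x⟩. So at cθ the gradient has no component along u, for any c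
(`integral_sigmoid_sub_mul_inner_eq_zero`). The remaining component, along θ, is negative at c = 0
because g(λ) and λ lie on the same side of 1/2, and nonnegative for large c because genuinely mixed
labels penalise large margins. It therefore vanishes at some c in an interval [lo, hi] that works
for every κ ≥ 1 (`exists_radialGradient_eq_zero`).

Curvature. On a ball of vectors of norm at most W, the second derivative of the loss at a mixed
point x is at least exp(-W‖x‖)/4 times the square of the component along x. The expected weighted
second moment in a direction v is at least of order ‖Tv‖², hence of order ‖v‖²/κ
(`exists_le_integral_exp_mul_sq_inner`).

Concentration. The summands over pairs (i, j) are dependent, but the off-diagonal pairs split into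
2n classes of disjoint pairs. Independence inside a class, Jensen across classes and a Chernoff
bound give tails exp(-const · n η²) (`measure_offDiag_ge_le`). The weight exp(-W‖x‖) is the same for
all vectors of the ball and cθ is not random, so 1 + d + d² statistics suffice and no covering
argument is needed. The diagonal contributes only order n out of n².

Conclusion. With η proportional to ε/κ, the empirical gradient at cθ is smaller than curvature times
radius for the radius ε c‖θ‖/2. The unique minimizer then lies within that radius of cθ
(`exists_isUniqueMinimizer_of_small_gradient`), which gives the bound on the cosine similarity. -/

/-! ### Exponential moments and tails of sums over off-diagonal pairs -/

/-- Factorization of the integral of a product over distinct coordinates. -/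
theorem lintegral_pi_prod_comp_injective {ι κ β : Type*} [Fintype ι] [Fintype κ] [MeasurableSpace β]
    (ν : Measure β) [IsProbabilityMeasure ν] {e : ι → κ} (he : Function.Injective e)
    {f : ι → β → ℝ≥0∞} (hf : ∀ i, Measurable (f i)) :
    ∫⁻ x : κ → β, ∏ i, f i (x (e i)) ∂(Measure.pi fun _ => ν) = ∏ i, ∫⁻ y, f i y ∂ν := by
  have h1 : iIndepFun (fun (k : κ) (x : κ → β) => x k) (Measure.pi fun _ => ν) :=
    iIndepFun_pi (X := fun _ y => y) (fun _ => aemeasurable_id)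
  have h2 := (h1.precomp he).comp f hf
  have h3 := lintegral_prod_eq_prod_lintegral_of_indepFun Finset.univ _ h2
    (fun i => (hf i).comp (measurable_pi_apply _))
  simp only [Function.comp_def] at h3
  rw [h3]
  refine Finset.prod_congr rfl fun i _ => ?_
  exact (measurePreserving_eval (fun _ : κ => ν) (e i)).lintegral_comp (hf i)

/-- Factorization of the integral of a product over disjoint pairs of coordinates. -/
theorem lintegral_pi_prod_pairs {ι β : Type*} [Fintype ι] [DecidableEq ι] [MeasurableSpace β]
    (ν : Measure β) [IsProbabilityMeasure ν] (s : Finset ι) {τ : ι → ι}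
    (hτ : Function.Injective τ) (hs : ∀ i ∈ s, τ i ∉ s)
    {f : β × β → ℝ≥0∞} (hf : Measurable f) :
    ∫⁻ x : ι → β, ∏ i ∈ s, f (x i, x (τ i)) ∂(Measure.pi fun _ => ν) =
      (∫⁻ y, f y ∂(ν.prod ν)) ^ s.card := by
  -- Split the coordinates into those in s and the others. All partners τ i lie among the others and
  -- are distinct, so they can be integrated out first, one factor each.
  have hmp := measurePreserving_piEquivPiSubtypeProd (fun _ : ι => ν) (fun i => i ∈ s)
  let e : {i // i ∈ s} → {i // i ∉ s} := fun i => ⟨τ i, hs i i.2⟩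
  have he : Function.Injective e := fun i j hij => by
    apply Subtype.ext
    exact hτ (congrArg Subtype.val hij)
  let F : ({i // i ∈ s} → β) × ({i // i ∉ s} → β) → ℝ≥0∞ :=
    fun p => ∏ i, f (p.1 i, p.2 (e i))
  have hF : Measurable F := by
    refine Finset.measurable_prod _ fun i _ => hf.comp ?_
    exact ((measurable_pi_apply i).comp measurable_fst).prodMk
      ((measurable_pi_apply (e i)).comp measurable_snd)
  have h1 : ∀ x : ι → β, ∏ i ∈ s, f (x i, x (τ i)) =
      F (MeasurableEquiv.piEquivPiSubtypeProd (fun _ : ι => β) (fun i => i ∈ s) x) := by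
    intro x
    rw [← Finset.prod_coe_sort]
    rfl
  simp_rw [h1]
  rw [hmp.lintegral_comp hF, lintegral_prod _ hF.aemeasurable]
  have h2 : ∀ a : {i // i ∈ s} → β,
      ∫⁻ b, F (a, b) ∂(Measure.pi fun _ => ν) = ∏ i, ∫⁻ y, f (a i, y) ∂ν := fun a =>
    lintegral_pi_prod_comp_injective ν he (f := fun i y => f (a i, y))
      (fun i => hf.comp (by fun_prop))
  simp_rw [h2]
  have h3 := lintegral_pi_prod_comp_injective ν (e := (id : {i // i ∈ s} → _))
    Function.injective_id (f := fun _ z => ∫⁻ y, f (z, y) ∂ν)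
    (fun i => hf.lintegral_prod_right')
  rw [Finset.prod_const, ← lintegral_prod _ hf.aemeasurable, Finset.card_univ,
    Fintype.card_coe] at h3
  rw [← h3]
  congr!

/-- The same with an independent family of weights attached to the pairs. -/
theorem lintegral_prod_pairs_weighted {ι β γ : Type*} [Fintype ι] [DecidableEq ι]
    [MeasurableSpace β] [MeasurableSpace γ]
    (ν : Measure β) [IsProbabilityMeasure ν] (L : Measure γ) [IsProbabilityMeasure L]
    (s : Finset ι) {τ : ι → ι}
    (hτ : Function.Injective τ) (hs : ∀ i ∈ s, τ i ∉ s)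
    {f : β × β × γ → ℝ≥0∞} (hf : Measurable f) :
    ∫⁻ ω : (ι → β) × (ι × ι → γ), ∏ i ∈ s, f (ω.1 i, ω.1 (τ i), ω.2 (i, τ i))
      ∂((Measure.pi fun _ => ν).prod (Measure.pi fun _ => L)) =
      (∫⁻ y, f y ∂(ν.prod (ν.prod L))) ^ s.card := by
  have hm : Measurable fun ω : (ι → β) × (ι × ι → γ) =>
      ∏ i ∈ s, f (ω.1 i, ω.1 (τ i), ω.2 (i, τ i)) :=
    Finset.measurable_prod _ fun i _ => hf.comp (by fun_prop)
  rw [lintegral_prod _ hm.aemeasurable]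
  -- For fixed points, the weights sit at the coordinates (i, τ i), which are distinct because their
  -- first entries are.
  have h1 : ∀ x : ι → β, ∫⁻ l : ι × ι → γ, ∏ i ∈ s, f (x i, x (τ i), l (i, τ i))
      ∂(Measure.pi fun _ => L) = ∏ i ∈ s, ∫⁻ y, f (x i, x (τ i), y) ∂L := by
    intro x
    simp_rw [← Finset.prod_coe_sort s]
    exact lintegral_pi_prod_comp_injective L (e := fun i : s => ((i : ι), τ i))
      (fun i j hij => Subtype.ext (congrArg Prod.fst hij))
      (f := fun i y => f (x i, x (τ i), y)) (fun i => hf.comp (by fun_prop))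
  simp_rw [h1]
  have hf' : Measurable fun p : (β × β) × γ => f (p.1.1, p.1.2, p.2) := hf.comp (by fun_prop)
  have h2 : Measurable fun p : β × β => ∫⁻ y, f (p.1, p.2, y) ∂L := hf'.lintegral_prod_right'
  rw [lintegral_pi_prod_pairs ν s hτ hs h2, lintegral_prod _ h2.aemeasurable,
    lintegral_prod _ hf.aemeasurable]
  congr 1
  refine lintegral_congr fun x => ?_
  rw [lintegral_prod]
  exact (hf.comp (by fun_prop)).aemeasurable

/-- The sum over off-diagonal pairs, grouped by the value of `i + j` and the order of `i` and `j`. -/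
theorem sum_offDiag_eq_sum_classes {n : ℕ} [NeZero n] (a : Fin n → Fin n → ℝ) :
    ∑ i, ∑ j, (if i = j then 0 else a i j) =
      ∑ c : Fin n × Bool, ∑ i ∈ Finset.univ.filter
        (fun i => if c.2 then i < c.1 - i else c.1 - i < i), a i (c.1 - i) := by
  rw [Fintype.sum_prod_type]
  -- Substitute j = s - i, with subtraction modulo n. For fixed s the map i ↦ s - i is an
  -- involution, and the order of i and s - i separates the two members of each orbit.
  have h1 : ∀ i, ∑ j, (if i = j then 0 else a i j) =
      ∑ s, (if i = s - i then 0 else a i (s - i)) := fun i =>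
    (Equiv.sum_comp (Equiv.subRight i) (fun j => if i = j then 0 else a i j)).symm
  simp_rw [h1]
  rw [Finset.sum_comm]
  refine Finset.sum_congr rfl fun s _ => ?_
  rw [Fintype.sum_bool]
  simp only [if_true, Bool.false_eq_true, if_false, Finset.sum_filter]
  rw [← Finset.sum_add_distrib]
  refine Finset.sum_congr rfl fun i _ => ?_
  rcases lt_trichotomy i (s - i) with h | h | h
  · simp [h, h.ne, h.not_gt]
  · rw [if_pos h, if_neg (h ▸ lt_irrefl _), if_neg (h ▸ lt_irrefl _), add_zero]
  · simp [h, h.ne', h.not_gt]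

/-- Jensen for the uniform average. It decouples dependent classes at the price of multiplying the
exponent by their number. -/
theorem exp_sum_le_avg {ι : Type*} [Fintype ι] [Nonempty ι] (T : ι → ℝ) :
    Real.exp (∑ c, T c) ≤
      (Fintype.card ι : ℝ)⁻¹ * ∑ c, Real.exp (Fintype.card ι * T c) := by
  have hN : (0 : ℝ) < Fintype.card ι := by exact_mod_cast Fintype.card_pos
  have := convexOn_exp.map_sum_le (t := Finset.univ) (w := fun _ : ι => (Fintype.card ι : ℝ)⁻¹)
    (p := fun c => Fintype.card ι * T c) (fun _ _ => by positivity)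
    (by simp [hN.ne']) (fun _ _ => Set.mem_univ _)
  simp only [smul_eq_mul, ← Finset.mul_sum] at this
  rwa [← mul_assoc, inv_mul_cancel₀ hN.ne', one_mul] at this

/-- Exponential moment of the off-diagonal sum. -/
theorem lintegral_exp_offDiag_le {n : ℕ} [NeZero n] {β γ : Type*}
    [MeasurableSpace β] [MeasurableSpace γ]
    (ν : Measure β) [IsProbabilityMeasure ν] (L : Measure γ) [IsProbabilityMeasure L]
    {f : β × β × γ → ℝ} (hf : Measurable f) {V t : ℝ} (hV : 0 ≤ V)
    (hmgf : ∫⁻ y, ENNReal.ofReal (Real.exp (2 * n * t * f y)) ∂(ν.prod (ν.prod L)) ≤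
      ENNReal.ofReal (Real.exp ((2 * n * t) ^ 2 * V))) :
    ∫⁻ ω : (Fin n → β) × (Fin n × Fin n → γ), ENNReal.ofReal (Real.exp
        (t * ∑ i, ∑ j, if i = j then 0 else f (ω.1 i, ω.1 j, ω.2 (i, j))))
      ∂((Measure.pi fun _ => ν).prod (Measure.pi fun _ => L)) ≤
      ENNReal.ofReal (Real.exp (n * ((2 * n * t) ^ 2 * V))) := by
  set P := (Measure.pi fun _ : Fin n => ν).prod (Measure.pi fun _ : Fin n × Fin n => L)
  have hn : (0 : ℝ) < n := by exact_mod_cast NeZero.pos n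
  let S : Fin n × Bool → Finset (Fin n) := fun c => Finset.univ.filter
        (fun i => if c.2 then i < c.1 - i else c.1 - i < i)
  let T : Fin n × Bool → ((Fin n → β) × (Fin n × Fin n → γ)) → ℝ := fun c ω =>
    ∑ i ∈ S c, f (ω.1 i, ω.1 (c.1 - i), ω.2 (i, c.1 - i))
  have hcard : (Fintype.card (Fin n × Bool) : ℝ) = 2 * n := by
    simp [mul_comm]
  have hT : ∀ c, Measurable (T c) := fun c =>
    Finset.measurable_sum _ fun i _ => hf.comp (by fun_prop)
  -- Within a class i + j is fixed and i, j are in a fixed order, so no index is used twice and the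
  -- factors are independent. A class has at most n members, and padding the power to n is harmless
  -- as the base is at least 1.
  have hclass : ∀ c, ∫⁻ ω, ENNReal.ofReal (Real.exp (2 * n * (t * T c ω))) ∂P ≤
      ENNReal.ofReal (Real.exp (n * ((2 * n * t) ^ 2 * V))) := by
    intro c
    have h1 : ∀ ω, ENNReal.ofReal (Real.exp (2 * n * (t * T c ω))) =
        ∏ i ∈ S c, ENNReal.ofReal (Real.exp (2 * n * t *
          f (ω.1 i, ω.1 (c.1 - i), ω.2 (i, c.1 - i)))) := by
      intro ω
      rw [← ENNReal.ofReal_prod_of_nonneg (fun _ _ => (Real.exp_pos _).le), ← Real.exp_sum,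
        ← Finset.mul_sum]
      simp only [T, mul_assoc]
    simp_rw [h1]
    rw [lintegral_prod_pairs_weighted ν L (S c) (τ := fun i => c.1 - i)
      (fun i j hij => sub_right_injective hij) ?_
      (f := fun y => ENNReal.ofReal (Real.exp (2 * n * t * f y))) (by fun_prop)]
    · calc _ ≤ (ENNReal.ofReal (Real.exp ((2 * n * t) ^ 2 * V))) ^ (S c).card := by gcongr
        _ ≤ (ENNReal.ofReal (Real.exp ((2 * n * t) ^ 2 * V))) ^ n := by
          refine pow_le_pow_right₀ ?_ ?_
          · rw [ENNReal.one_le_ofReal]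
            exact Real.one_le_exp (by positivity)
          · simpa using Finset.card_le_univ (S c)
        _ = _ := by
          rw [← ENNReal.ofReal_pow (Real.exp_pos _).le, ← Real.exp_nat_mul]
    · intro i hi
      simp only [S, Finset.mem_filter, Finset.mem_univ, true_and, sub_sub_cancel] at hi ⊢
      split_ifs at hi ⊢ with hc
      · exact hi.not_gt
      · exact hi.not_gt
  have hpt : ∀ ω : (Fin n → β) × (Fin n × Fin n → γ), ENNReal.ofReal (Real.exp
        (t * ∑ i, ∑ j, if i = j then 0 else f (ω.1 i, ω.1 j, ω.2 (i, j)))) ≤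
      ENNReal.ofReal ((2 * n : ℝ)⁻¹) *
        ∑ c, ENNReal.ofReal (Real.exp (2 * n * (t * T c ω))) := by
    intro ω
    rw [← ENNReal.ofReal_sum_of_nonneg (fun _ _ => (Real.exp_pos _).le),
      ← ENNReal.ofReal_mul (by positivity)]
    refine ENNReal.ofReal_le_ofReal ?_
    rw [sum_offDiag_eq_sum_classes (fun i j => f (ω.1 i, ω.1 j, ω.2 (i, j))), Finset.mul_sum]
    have := exp_sum_le_avg (fun c => t * T c ω)
    rw [hcard] at this
    exact this
  refine (lintegral_mono hpt).trans ?_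
  rw [lintegral_const_mul _ (Finset.measurable_sum _ fun c _ => by
    have := hT c
    fun_prop), lintegral_finsetSum _ (fun c _ => by
    have := hT c
    fun_prop)]
  calc _ ≤ ENNReal.ofReal ((2 * n : ℝ)⁻¹) *
        ∑ _c : Fin n × Bool, ENNReal.ofReal (Real.exp (n * ((2 * n * t) ^ 2 * V))) := by
        gcongr with c
        exact hclass c
    _ = _ := by
      rw [Finset.sum_const, nsmul_eq_mul, ← mul_assoc, Finset.card_univ,
        ← ENNReal.ofReal_natCast, ← ENNReal.ofReal_mul (by positivity), hcard,
        inv_mul_cancel₀ (by positivity), ENNReal.ofReal_one, one_mul]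

/-- Upper tail of the off-diagonal sum of a function with Gaussian-type exponential moments. -/
theorem measure_offDiag_ge_le {n : ℕ} [NeZero n] {β γ : Type*}
    [MeasurableSpace β] [MeasurableSpace γ]
    (ν : Measure β) [IsProbabilityMeasure ν] (L : Measure γ) [IsProbabilityMeasure L]
    {f : β × β × γ → ℝ} (hf : Measurable f) {V η : ℝ} (hV : 0 < V) (hη : 0 < η)
    (hηV : η ≤ 4 * V)
    (hmgf : ∀ a : ℝ, |a| ≤ 1 → ∫⁻ y, ENNReal.ofReal (Real.exp (a * f y)) ∂(ν.prod (ν.prod L)) ≤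
      ENNReal.ofReal (Real.exp (a ^ 2 * V))) :
    ((Measure.pi fun _ : Fin n => ν).prod (Measure.pi fun _ : Fin n × Fin n => L))
      {ω | η * (n : ℝ) ^ 2 ≤ ∑ i, ∑ j, if i = j then 0 else f (ω.1 i, ω.1 j, ω.2 (i, j))} ≤
      ENNReal.ofReal (Real.exp (-(n * η ^ 2 / (16 * V)))) := by
  set P := (Measure.pi fun _ : Fin n => ν).prod (Measure.pi fun _ : Fin n × Fin n => L)
  have hn : (0 : ℝ) < n := by exact_mod_cast NeZero.pos n
  -- This t minimises -tηn² + n(2nt)²V. The condition η ≤ 4V keeps 2nt in the range where the moment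
  -- bound is available.
  set t : ℝ := η / (8 * V * n) with ht
  have ht0 : 0 < t := by positivity
  have h2nt : 2 * n * t = η / (4 * V) := by rw [ht]; field_simp; norm_num
  have hint := lintegral_exp_offDiag_le (n := n) ν L hf (t := t) hV.le (hmgf _ (by
    rw [h2nt, abs_of_pos (by positivity), div_le_one (by positivity)]; exact hηV))
  set W : ((Fin n → β) × (Fin n × Fin n → γ)) → ℝ := fun ω =>
    ∑ i, ∑ j, if i = j then 0 else f (ω.1 i, ω.1 j, ω.2 (i, j)) with hW
  have hWm : Measurable W := by
    refine Finset.measurable_sum _ fun i _ => Finset.measurable_sum _ fun j _ => ?_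
    split_ifs
    · exact measurable_const
    · exact hf.comp (by fun_prop)
  have hmark := mul_meas_ge_le_lintegral (μ := P)
    (f := fun ω => ENNReal.ofReal (Real.exp (t * W ω))) (by fun_prop)
    (ENNReal.ofReal (Real.exp (t * (η * (n : ℝ) ^ 2))))
  have hsub : {ω | η * (n : ℝ) ^ 2 ≤ W ω} ⊆ {ω | ENNReal.ofReal (Real.exp (t * (η * (n : ℝ) ^ 2)))
      ≤ ENNReal.ofReal (Real.exp (t * W ω))} := fun ω hω => by
    refine ENNReal.ofReal_le_ofReal (Real.exp_le_exp.2 ?_)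
    exact mul_le_mul_of_nonneg_left hω ht0.le
  have h3 : ENNReal.ofReal (Real.exp (t * (η * (n : ℝ) ^ 2))) * P {ω | η * (n : ℝ) ^ 2 ≤ W ω} ≤
      ENNReal.ofReal (Real.exp (n * ((2 * n * t) ^ 2 * V))) :=
    (mul_le_mul_right (measure_mono hsub) _).trans (hmark.trans hint)
  have h4 : ENNReal.ofReal (Real.exp (-(n * η ^ 2 / (16 * V)))) ≥
      ENNReal.ofReal (Real.exp (-(t * (η * (n : ℝ) ^ 2)))) *
        ENNReal.ofReal (Real.exp (n * ((2 * n * t) ^ 2 * V))) := by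
    rw [← ENNReal.ofReal_mul (Real.exp_pos _).le, ← Real.exp_add]
    refine ENNReal.ofReal_le_ofReal (Real.exp_le_exp.2 ?_)
    rw [h2nt, ht]
    apply le_of_eq
    field_simp
    ring
  refine le_trans ?_ h4
  refine le_trans ?_ (mul_le_mul_right h3 _)
  rw [← mul_assoc, ← ENNReal.ofReal_mul (Real.exp_pos _).le, ← Real.exp_add]
  simp [hW]

/-- For |u| ≤ 1 the Taylor remainder is at most u²; for |u| > 1 the factor u² exceeds 1 and exp |u|
alone dominates. The linear term is kept exact so that it disappears for centered variables. -/
theorem exp_le_one_add_add_sq_mul_exp_abs (u : ℝ) :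
    Real.exp u ≤ 1 + u + u ^ 2 * Real.exp |u| := by
  by_cases h : |u| ≤ 1
  · have h1 := (abs_le.1 (Real.abs_exp_sub_one_sub_id_le h)).2
    have h2 : 1 ≤ Real.exp |u| := Real.one_le_exp (abs_nonneg u)
    nlinarith [sq_nonneg u]
  · push Not at h
    have h1 : Real.exp u ≤ Real.exp |u| := Real.exp_le_exp.2 (le_abs_self u)
    have h2 : |u| + 1 ≤ Real.exp |u| := Real.add_one_le_exp _
    have h3 := neg_abs_le u
    rw [← sq_abs]
    have h5 : Real.exp |u| ≤ |u| ^ 2 * Real.exp |u| :=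
      le_mul_of_one_le_left (Real.exp_pos _).le (one_le_pow₀ h.le)
    rcases le_or_gt 0 u with hu | hu
    · linarith
    · have : Real.exp u ≤ 1 := Real.exp_le_one_iff.2 hu.le
      nlinarith [Real.exp_pos |u|]

/-- A centered variable with an exponential moment has Gaussian-type exponential moments near
zero. -/
theorem lintegral_exp_mul_le_of_centered {Ω : Type*} [MeasurableSpace Ω] {P : Measure Ω}
    [IsProbabilityMeasure P] {X : Ω → ℝ} (hX : Measurable X) (hX0 : ∫ ω, X ω ∂P = 0)
    {Y : Ω → ℝ} (hXY : ∀ ω, |X ω| ≤ Y ω) (hYi : Integrable (fun ω => Real.exp (2 * Y ω)) P)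
    {M : ℝ} (hYM : ∫ ω, Real.exp (2 * Y ω) ∂P ≤ M) {a : ℝ} (ha : |a| ≤ 1) :
    ∫⁻ ω, ENNReal.ofReal (Real.exp (a * X ω)) ∂P ≤ ENNReal.ofReal (Real.exp (a ^ 2 * (2 * M))) := by
  -- Both X² ≤ 2 exp Y and exp |aX| ≤ exp Y, so the remainder is at most 2a² exp(2Y); this is why
  -- the moment of exp(2Y) is assumed.
  have hpt : ∀ ω, Real.exp (a * X ω) ≤ 1 + a * X ω + a ^ 2 * (2 * Real.exp (2 * Y ω)) := by
    intro ω
    refine (exp_le_one_add_add_sq_mul_exp_abs _).trans ?_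
    have hY0 : 0 ≤ Y ω := (abs_nonneg _).trans (hXY ω)
    have h1 : Real.exp |a * X ω| ≤ Real.exp (Y ω) := by
      refine Real.exp_le_exp.2 ?_
      rw [abs_mul]
      nlinarith [hXY ω, abs_nonneg (X ω)]
    have h2 : X ω ^ 2 ≤ 2 * Real.exp (Y ω) := by
      have := Real.quadratic_le_exp_of_nonneg hY0
      have h3 : X ω ^ 2 ≤ Y ω ^ 2 := sq_le_sq' (by linarith [(abs_le.1 (hXY ω)).1])
        (abs_le.1 (hXY ω)).2
      nlinarith
    have h4 : Real.exp (2 * Y ω) = Real.exp (Y ω) * Real.exp (Y ω) := by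
      rw [← Real.exp_add]; ring_nf
    rw [h4, mul_pow]
    have : X ω ^ 2 * Real.exp |a * X ω| ≤ 2 * Real.exp (Y ω) * Real.exp (Y ω) :=
      mul_le_mul h2 h1 (Real.exp_pos _).le (by positivity)
    nlinarith [mul_le_mul_of_nonneg_left this (sq_nonneg a)]
  have hYmeas : Integrable X P := by
    refine hYi.mono' hX.aestronglyMeasurable (ae_of_all _ fun ω => ?_)
    rw [Real.norm_eq_abs]
    have := Real.add_one_le_exp (2 * Y ω)
    have := (abs_nonneg _).trans (hXY ω)
    linarith [hXY ω]
  have hint : Integrable (fun ω => 1 + a * X ω + a ^ 2 * (2 * Real.exp (2 * Y ω))) P :=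
    ((integrable_const 1).add (hYmeas.const_mul a)).add ((hYi.const_mul 2).const_mul _)
  calc _ ≤ ∫⁻ ω, ENNReal.ofReal (1 + a * X ω + a ^ 2 * (2 * Real.exp (2 * Y ω))) ∂P :=
        lintegral_mono fun ω => ENNReal.ofReal_le_ofReal (hpt ω)
    _ = ENNReal.ofReal (∫ ω, (1 + a * X ω + a ^ 2 * (2 * Real.exp (2 * Y ω))) ∂P) := by
        rw [ofReal_integral_eq_lintegral_ofReal hint
          (ae_of_all _ fun ω => (Real.exp_pos _).le.trans (hpt ω))]
    _ ≤ _ := by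
        refine ENNReal.ofReal_le_ofReal ?_
        rw [integral_add (f := fun ω => 1 + a * X ω)
          ((integrable_const 1).add (hYmeas.const_mul a))
          ((hYi.const_mul 2).const_mul _), integral_add (integrable_const 1) (hYmeas.const_mul a),
          integral_const_mul, integral_const_mul, integral_const_mul, hX0]
        simp only [integral_const, probReal_univ, smul_eq_mul, mul_one, mul_zero, add_zero]
        have := Real.add_one_le_exp (a ^ 2 * (2 * M))
        have := mul_le_mul_of_nonneg_left hYM (sq_nonneg a)
        nlinarith

/-! ### Convexity of the logistic loss -/

/-- The softplus function. -/
noncomputable def softplus (z : ℝ) : ℝ := Real.log (1 + Real.exp z)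

theorem logisticLoss_neg (z : ℝ) : logisticLoss (-z) = softplus z := by
  simp [logisticLoss, softplus]

theorem logisticLoss_eq (z : ℝ) : logisticLoss z = softplus z - z := by
  have h : 1 + Real.exp (-z) = (1 + Real.exp z) * Real.exp (-z) := by
    rw [add_mul, ← Real.exp_add]; simp [add_comm]
  rw [logisticLoss, h, Real.log_mul (by positivity) (by positivity), Real.log_exp, softplus]
  ring

/-- The label enters linearly, so convexity and curvature in w do not depend on the labels. -/
theorem pointLoss_eq {d : ℕ} (w x : EuclideanSpace ℝ (Fin d)) (y : ℝ) :
    pointLoss w x y = softplus (inner ℝ w x) - y * inner ℝ w x := by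
  rw [pointLoss, logisticLoss_neg, logisticLoss_eq]; ring

theorem hasDerivAt_softplus (z : ℝ) : HasDerivAt softplus (Real.sigmoid z) z := by
  have h := ((Real.hasDerivAt_exp z).const_add 1).log (by positivity)
  have e : Real.sigmoid z = Real.exp z / (1 + Real.exp z) := by
    rw [Real.sigmoid_def, Real.exp_neg]
    field_simp
    ring
  rw [e]
  exact h

/-- Both sides are even. For z ≥ 0 the right side equals σ(z)² exp(-z), with σ(z) ≥ 1/2. -/
theorem exp_neg_abs_le_sigmoid_mul (z : ℝ) :
    Real.exp (-|z|) / 4 ≤ Real.sigmoid z * (1 - Real.sigmoid z) := by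
  wlog hz : 0 ≤ z generalizing z
  · have := this (-z) (by linarith)
    rw [abs_neg, Real.sigmoid_neg] at this
    linarith
  rw [abs_of_nonneg hz, ← Real.sigmoid_neg, ← Real.sigmoid_mul_rexp_neg]
  have h : 1 / 2 ≤ Real.sigmoid z := by
    have := Real.sigmoid_le hz
    rw [Real.sigmoid_zero] at this
    linarith
  nlinarith [Real.exp_pos (-z), mul_le_mul h h (by norm_num) (by linarith)]

/-- A function on an interval lies above its tangent lines, quantitatively. -/
theorem le_of_hasDerivAt_of_monotoneOn {φ φ' : ℝ → ℝ} {s : Set ℝ} (hs : Convex ℝ s)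
    (hφ : ∀ x, HasDerivAt φ (φ' x) x) (hmono : MonotoneOn φ' s) {a b : ℝ} (ha : a ∈ s)
    (hb : b ∈ s) : φ a + φ' a * (b - a) ≤ φ b := by
  have hsub : Set.uIcc a b ⊆ s := by
    rw [← segment_eq_uIcc]; exact hs.segment_subset ha hb
  rcases lt_trichotomy a b with h | h | h
  · obtain ⟨c, hc, hc'⟩ := exists_hasDerivAt_eq_slope φ φ' h
      (fun x _ => (hφ x).continuousAt.continuousWithinAt) (fun x _ => hφ x)
    have : φ' a ≤ φ' c := hmono ha (hsub (by
      rw [Set.uIcc_of_le h.le]; exact Set.Ioo_subset_Icc_self hc)) hc.1.le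
    rw [eq_div_iff (sub_pos.2 h).ne'] at hc'
    nlinarith [sub_pos.2 h]
  · subst h; simp
  · obtain ⟨c, hc, hc'⟩ := exists_hasDerivAt_eq_slope φ φ' h
      (fun x _ => (hφ x).continuousAt.continuousWithinAt) (fun x _ => hφ x)
    have : φ' c ≤ φ' a := hmono (hsub (by
      rw [Set.uIcc_of_ge h.le]; exact Set.Ioo_subset_Icc_self hc)) ha hc.2.le
    rw [eq_div_iff (sub_pos.2 h).ne'] at hc'
    nlinarith [sub_pos.2 h]

theorem softplus_tangent_le (a b : ℝ) :
    softplus a + Real.sigmoid a * (b - a) ≤ softplus b :=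
  le_of_hasDerivAt_of_monotoneOn convex_univ hasDerivAt_softplus
    (Real.sigmoid_monotone.monotoneOn _) (Set.mem_univ a) (Set.mem_univ b)

/-- On [-m, m] the second derivative of softplus is at least exp(-m)/4, so subtracting exp(-m)/8 ·
x² leaves a function with monotone derivative, which lies above its tangents. -/
theorem softplus_strong_tangent_le {a b m : ℝ} (ha : |a| ≤ m) (hb : |b| ≤ m) :
    softplus a + Real.sigmoid a * (b - a) + Real.exp (-m) / 8 * (b - a) ^ 2 ≤ softplus b := by
  have hφ : ∀ x, HasDerivAt (fun x => softplus x - Real.exp (-m) / 8 * x ^ 2)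
      (Real.sigmoid x - Real.exp (-m) / 4 * x) x := by
    intro x
    have := (hasDerivAt_softplus x).sub (((hasDerivAt_id x).pow 2).const_mul (Real.exp (-m) / 8))
    refine this.congr_deriv ?_
    simp only [id]
    ring
  have hmono : MonotoneOn (fun x => Real.sigmoid x - Real.exp (-m) / 4 * x) (Set.Icc (-m) m) := by
    refine monotoneOn_of_hasDerivWithinAt_nonneg (f' := fun x =>
      Real.sigmoid x * (1 - Real.sigmoid x) - Real.exp (-m) / 4) (convex_Icc _ _)
      (by have := continuous_sigmoid; fun_prop) (fun x _ => ?_) (fun x hx => ?_)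
    · have := (Real.hasDerivAt_sigmoid x).sub ((hasDerivAt_id x).const_mul (Real.exp (-m) / 4))
      simp only [mul_one] at this
      exact this.hasDerivWithinAt
    · have hx' : |x| ≤ m := abs_le.2 (Set.mem_Icc.1 (interior_subset hx))
      have := exp_neg_abs_le_sigmoid_mul x
      have : Real.exp (-m) ≤ Real.exp (-|x|) := Real.exp_le_exp.2 (by linarith)
      linarith
  have := le_of_hasDerivAt_of_monotoneOn (convex_Icc (-m) m) hφ hmono (abs_le.1 ha) (abs_le.1 hb)
  nlinarith

/-! ### Locating the minimizer, and cosine similarity -/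

/-- A convex function, strongly convex in a ball around a point with small gradient, has a unique
minimizer, and it lies in that ball. -/
theorem exists_isUniqueMinimizer_of_small_gradient {E : Type*} [NormedAddCommGroup E]
    [InnerProductSpace ℝ E] [FiniteDimensional ℝ E] {f : E → ℝ} {G : E → E} {w₀ : E} {r c : ℝ}
    (hr : 0 < r) (hc : 0 < c) (hf : Continuous f)
    (hsub : ∀ w v, f w + inner ℝ (G w) (v - w) ≤ f v)
    (hstrong : ∀ w ∈ Metric.closedBall w₀ r, ∀ v ∈ Metric.closedBall w₀ r,
      f w + inner ℝ (G w) (v - w) + c * ‖v - w‖ ^ 2 ≤ f v)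
    (hG : ‖G w₀‖ < c * r) :
    ∃ w, IsUniqueMinimizer f w ∧ ‖w - w₀‖ ≤ r := by
  have h0 : w₀ ∈ Metric.closedBall w₀ r := Metric.mem_closedBall_self hr.le
  -- The quadratic gain c r² beats the loss ‖G w₀‖ r of the linear term.
  have hsphere : ∀ v, ‖v - w₀‖ = r → f w₀ < f v := by
    intro v hv
    have h1 := hstrong w₀ h0 v (by rw [mem_closedBall_iff_norm, hv])
    have h2 := neg_le_of_abs_le (abs_real_inner_le_norm (G w₀) (v - w₀))
    rw [hv] at h1 h2
    nlinarith
  -- The segment from w₀ to v crosses the sphere at p. The subgradient inequalities at p towards v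
  -- and towards w₀ combine to plain convexity along the segment, so f, having risen at p, is larger
  -- still at v.
  have hout : ∀ v, r < ‖v - w₀‖ → f w₀ < f v := by
    intro v hv
    have hv0 : 0 < ‖v - w₀‖ := hr.trans hv
    set t := r / ‖v - w₀‖ with ht
    have ht0 : 0 < t := by positivity
    have ht1 : t < 1 := (div_lt_one hv0).2 hv
    set p := w₀ + t • (v - w₀) with hp
    have hps : ‖p - w₀‖ = r := by
      rw [hp, add_sub_cancel_left, norm_smul, Real.norm_of_nonneg ht0.le, ht]
      field_simp
    have h1 := hsub p v
    have h2 := hsub p w₀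
    have e1 : v - p = (1 - t) • (v - w₀) := by rw [hp]; module
    have e2 : w₀ - p = (-t) • (v - w₀) := by rw [hp]; module
    rw [e1, inner_smul_right] at h1
    rw [e2, inner_smul_right] at h2
    have h3 := hsphere p hps
    have h4 : t * (f v - f w₀) ≥ f p - f w₀ := by nlinarith
    by_contra hcon
    nlinarith
  obtain ⟨w, hw, hwmin⟩ := (isCompact_closedBall w₀ r).exists_isMinOn ⟨w₀, h0⟩ hf.continuousOn
  have hmin : ∀ v, f w ≤ f v := by
    intro v
    by_cases hv : v ∈ Metric.closedBall w₀ r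
    · exact hwmin hv
    · rw [mem_closedBall_iff_norm, not_le] at hv
      exact (hwmin h0).trans (hout v hv).le
  refine ⟨w, ⟨hmin, fun v hv => ?_⟩, mem_closedBall_iff_norm.1 hw⟩
  have hvb : v ∈ Metric.closedBall w₀ r := by
    rw [mem_closedBall_iff_norm]
    by_contra hcon
    exact absurd (hv w₀) (not_le.2 (hout v (not_le.1 hcon)))
  -- Two minimizers in the ball: strong convexity at the midpoint would push it strictly below both
  -- unless they coincide.
  set p := w + (1 / 2 : ℝ) • (v - w) with hp
  have hpb : p ∈ Metric.closedBall w₀ r :=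
    (convex_closedBall w₀ r).add_smul_sub_mem hw hvb ⟨by norm_num, by norm_num⟩
  have h1 := hstrong p hpb v hvb
  have h2 := hstrong p hpb w hw
  have e1 : v - p = (1 / 2 : ℝ) • (v - w) := by rw [hp]; module
  have e2 : w - p = (-(1 / 2) : ℝ) • (v - w) := by rw [hp]; module
  rw [e1, inner_smul_right, norm_smul] at h1
  rw [e2, inner_smul_right, norm_smul] at h2
  have h3 := hmin p
  have h4 := hv p
  have h5 : c * ‖v - w‖ ^ 2 ≤ 0 := by
    norm_num [mul_pow] at h1 h2
    nlinarith
  have h6 : ‖v - w‖ = 0 := by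
    by_contra hne
    have : 0 < c * ‖v - w‖ ^ 2 := by positivity
    linarith
  exact sub_eq_zero.1 (norm_eq_zero.1 h6)

/-- Here ⟨w, θ⟩ ≥ (1 - ε/2) c‖θ‖² and ‖w‖ ≤ (1 + ε/2) c‖θ‖, while (1 - ε)(1 + ε/2) ≤ 1 - ε/2. -/
theorem le_cosSim_of_norm_sub_le {d : ℕ} {w θ : EuclideanSpace ℝ (Fin d)} {c ε : ℝ} (hc : 0 < c)
    (hθ : θ ≠ 0) (hε : 0 < ε) (hε1 : ε < 1) (h : ‖w - c • θ‖ ≤ ε / 2 * (c * ‖θ‖)) :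
    w ≠ 0 ∧ 1 - ε ≤ cosSim w θ := by
  have hθ' : 0 < ‖θ‖ := norm_pos_iff.2 hθ
  have hn : ‖c • θ‖ = c * ‖θ‖ := by rw [norm_smul, Real.norm_of_nonneg hc.le]
  have hw : w ≠ 0 := by
    rintro rfl
    rw [zero_sub, norm_neg, hn] at h
    nlinarith [mul_pos hc hθ']
  refine ⟨hw, ?_⟩
  have hw' : 0 < ‖w‖ := norm_pos_iff.2 hw
  rw [cosSim, le_div_iff₀ (by positivity)]
  have h1 : ‖w‖ ≤ (1 + ε / 2) * (c * ‖θ‖) := by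
    have := norm_add_le (w - c • θ) (c • θ)
    rw [sub_add_cancel, hn] at this
    linarith
  have h2 : inner ℝ w θ = inner ℝ (w - c • θ) θ + c * ‖θ‖ ^ 2 := by
    rw [inner_sub_left, inner_smul_left, real_inner_self_eq_norm_sq]; simp
  have h3 := neg_le_of_abs_le (abs_real_inner_le_norm (w - c • θ) θ)
  have h4 : ‖w - c • θ‖ * ‖θ‖ ≤ ε / 2 * (c * ‖θ‖) * ‖θ‖ := by gcongr
  have h5 : (1 - ε) * (‖w‖ * ‖θ‖) ≤ (1 - ε) * ((1 + ε / 2) * (c * ‖θ‖) * ‖θ‖) := by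
    have : 0 ≤ 1 - ε := by linarith
    gcongr
  rw [h2]
  nlinarith [mul_pos (mul_pos hc hθ') hθ', mul_pos hε (mul_pos (mul_pos hc hθ') hθ'),
    mul_pos hε (mul_pos hε (mul_pos (mul_pos hc hθ') hθ'))]

/-! ### Latent coin and Gaussian noise, and their symmetries -/

/-- The uniform law on `Bool`. -/
noncomputable def fairCoin : Measure Bool :=
  (2⁻¹ : ℝ≥0∞) • Measure.dirac true + (2⁻¹ : ℝ≥0∞) • Measure.dirac false

/-- The sign `±1` of a Boolean. -/
def boolSign (b : Bool) : ℝ := if b then 1 else -1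

/-- The law of a fair class and an independent standard Gaussian noise vector. -/
noncomputable def latentLaw (d : ℕ) : Measure (Bool × EuclideanSpace ℝ (Fin d)) :=
  fairCoin.prod (stdGaussian _)

/-- The data point with given class and noise. -/
noncomputable def latentPoint {d : ℕ} (m : EuclideanSpace ℝ (Fin d))
    (T : EuclideanSpace ℝ (Fin d) →L[ℝ] EuclideanSpace ℝ (Fin d))
    (q : Bool × EuclideanSpace ℝ (Fin d)) : EuclideanSpace ℝ (Fin d) × ℝ :=
  (boolSign q.1 • m + T q.2, (1 + boolSign q.1) / 2)

theorem boolSign_sq (b : Bool) : boolSign b ^ 2 = 1 := by cases b <;> simp [boolSign]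

theorem boolSign_not (b : Bool) : boolSign (!b) = -boolSign b := by cases b <;> simp [boolSign]

theorem abs_boolSign (b : Bool) : |boolSign b| = 1 := by cases b <;> simp [boolSign]

@[fun_prop]
theorem measurable_boolSign : Measurable boolSign := measurable_of_finite _

instance : IsProbabilityMeasure fairCoin :=
  ⟨by simp [fairCoin, ENNReal.inv_two_add_inv_two]⟩

instance (d : ℕ) : IsProbabilityMeasure (latentLaw d) := by
  unfold latentLaw; infer_instance

@[fun_prop]
theorem measurable_latentPoint {d : ℕ} (m : EuclideanSpace ℝ (Fin d))
    (T : EuclideanSpace ℝ (Fin d) →L[ℝ] EuclideanSpace ℝ (Fin d)) :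
    Measurable (latentPoint m T) := by
  unfold latentPoint; fun_prop

-- The latent law does not involve m, C or κ: these enter only through the map. Symmetries of coin
-- and Gaussian become available, and domination can be made uniform in κ.
open scoped MatrixOrder in
theorem dataLaw_eq_map {d : ℕ} (m : EuclideanSpace ℝ (Fin d)) (C : Matrix (Fin d) (Fin d) ℝ)
    (κ : ℝ) : dataLaw m C κ =
      (latentLaw d).map (latentPoint m (Matrix.toEuclideanCLM (𝕜 := ℝ) (CFC.sqrt (κ⁻¹ • C)))) := by
  set T := Matrix.toEuclideanCLM (n := Fin d) (𝕜 := ℝ) (CFC.sqrt (κ⁻¹ • C)) with hT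
  have hg : ∀ (m' : EuclideanSpace ℝ (Fin d)) (y : ℝ),
      (multivariateGaussian m' (κ⁻¹ • C)).prod (Measure.dirac y) =
        (stdGaussian (EuclideanSpace ℝ (Fin d))).map (fun x => (m' + T x, y)) := by
    intro m' y
    rw [Measure.prod_dirac, multivariateGaussian, Measure.map_map (by fun_prop) (by fun_prop)]
    rfl
  rw [dataLaw, hg, hg, latentLaw, fairCoin, Measure.add_prod, Measure.prod_smul_left,
    Measure.prod_smul_left, Measure.dirac_prod, Measure.dirac_prod, Measure.map_add _ _ (by fun_prop),
    Measure.map_smul, Measure.map_smul, Measure.map_map (by fun_prop) (by fun_prop),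
    Measure.map_map (by fun_prop) (by fun_prop)]
  congr 4 <;> · funext x; simp [latentPoint, boolSign]

instance {d : ℕ} (m : EuclideanSpace ℝ (Fin d)) (C : Matrix (Fin d) (Fin d) ℝ)
    (κ : ℝ) : IsProbabilityMeasure (dataLaw m C κ) := by
  rw [dataLaw_eq_map]
  exact Measure.isProbabilityMeasure_map (by fun_prop)

/-- The mixed point of a pair of data points. -/
def pairPoint {d : ℕ} (g : I → I)
    (q : (EuclideanSpace ℝ (Fin d) × ℝ) × (EuclideanSpace ℝ (Fin d) × ℝ) × I) :
    EuclideanSpace ℝ (Fin d) :=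
  (g q.2.2 : ℝ) • q.1.1 + (1 - (g q.2.2 : ℝ)) • q.2.1.1

/-- The mixed label of a pair of data points. -/
def pairLabel {d : ℕ}
    (q : (EuclideanSpace ℝ (Fin d) × ℝ) × (EuclideanSpace ℝ (Fin d) × ℝ) × I) : ℝ :=
  (q.2.2 : ℝ) * q.1.2 + (1 - (q.2.2 : ℝ)) * q.2.1.2

@[fun_prop]
theorem measurable_pairPoint {d : ℕ} {g : I → I} (hg : Measurable g) :
    Measurable (pairPoint (d := d) g) := by
  unfold pairPoint; fun_prop

@[fun_prop]
theorem measurable_pairLabel {d : ℕ} : Measurable (pairLabel (d := d)) := by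
  unfold pairLabel; fun_prop

/-- The law of a pair of latent variables and a mixing coefficient. -/
noncomputable def latentPairLaw (d : ℕ) (L : Measure I) :
    Measure ((Bool × EuclideanSpace ℝ (Fin d)) × (Bool × EuclideanSpace ℝ (Fin d)) × I) :=
  (latentLaw d).prod ((latentLaw d).prod L)

instance (d : ℕ) (L : Measure I) [IsProbabilityMeasure L] :
    IsProbabilityMeasure (latentPairLaw d L) := by
  unfold latentPairLaw; infer_instance

/-- The pair of data points with given latent variables. -/
noncomputable def latentPair {d : ℕ} (m : EuclideanSpace ℝ (Fin d))
    (T : EuclideanSpace ℝ (Fin d) →L[ℝ] EuclideanSpace ℝ (Fin d))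
    (q : (Bool × EuclideanSpace ℝ (Fin d)) × (Bool × EuclideanSpace ℝ (Fin d)) × I) :
    (EuclideanSpace ℝ (Fin d) × ℝ) × (EuclideanSpace ℝ (Fin d) × ℝ) × I :=
  (latentPoint m T q.1, latentPoint m T q.2.1, q.2.2)

@[fun_prop]
theorem measurable_latentPair {d : ℕ} (m : EuclideanSpace ℝ (Fin d))
    (T : EuclideanSpace ℝ (Fin d) →L[ℝ] EuclideanSpace ℝ (Fin d)) :
    Measurable (latentPair m T) := by
  unfold latentPair; fun_prop

open scoped MatrixOrder in
theorem dataLaw_pair_eq_map {d : ℕ} (m : EuclideanSpace ℝ (Fin d))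
    (C : Matrix (Fin d) (Fin d) ℝ) (κ : ℝ) (L : Measure I) [IsProbabilityMeasure L] :
    (dataLaw m C κ).prod ((dataLaw m C κ).prod L) = (latentPairLaw d L).map
      (latentPair m (Matrix.toEuclideanCLM (𝕜 := ℝ) (CFC.sqrt (κ⁻¹ • C)))) := by
  have h : MeasurePreserving
      (latentPoint m (Matrix.toEuclideanCLM (𝕜 := ℝ) (CFC.sqrt (κ⁻¹ • C))))
      (latentLaw d) (dataLaw m C κ) := ⟨by fun_prop, (dataLaw_eq_map m C κ).symm⟩
  exact (h.prod (h.prod (MeasurePreserving.id L))).map_eq.symm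

/-- An integrand that is odd under a measure-preserving change of variables integrates to zero. Two
separate maps are allowed so that one point of the pair can be transformed alone. -/
theorem integral_latentPairLaw_eq_zero {d : ℕ} {L : Measure I} [IsProbabilityMeasure L]
    {ψ ψ' : Bool × EuclideanSpace ℝ (Fin d) → Bool × EuclideanSpace ℝ (Fin d)}
    (hψ : MeasurePreserving ψ (latentLaw d) (latentLaw d))
    (hψ' : MeasurePreserving ψ' (latentLaw d) (latentLaw d))
    {f : (Bool × EuclideanSpace ℝ (Fin d)) × (Bool × EuclideanSpace ℝ (Fin d)) × I → ℝ}
    (hf : Measurable f) (hfψ : ∀ q, f (ψ q.1, ψ' q.2.1, q.2.2) = -f q) :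
    ∫ q, f q ∂(latentPairLaw d L) = 0 := by
  have h : MeasurePreserving (Prod.map ψ (Prod.map ψ' id)) (latentPairLaw d L)
      (latentPairLaw d L) := hψ.prod (hψ'.prod (MeasurePreserving.id L))
  have h1 : ∫ q, f (Prod.map ψ (Prod.map ψ' id) q) ∂(latentPairLaw d L) =
      ∫ q, f q ∂(latentPairLaw d L) := by
    rw [← integral_map h.measurable.aemeasurable hf.aestronglyMeasurable, h.map_eq]
  have h2 : ∀ q, f (Prod.map ψ (Prod.map ψ' id) q) = -f q := hfψ
  simp_rw [h2, integral_neg] at h1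
  linarith

theorem measurePreserving_latent_isometry {d : ℕ}
    (R : EuclideanSpace ℝ (Fin d) ≃ₗᵢ[ℝ] EuclideanSpace ℝ (Fin d)) :
    MeasurePreserving (fun q : Bool × EuclideanSpace ℝ (Fin d) => (q.1, R q.2))
      (latentLaw d) (latentLaw d) :=
  (MeasurePreserving.id fairCoin).prod ⟨by fun_prop, stdGaussian_map R⟩

/-- Flipping class and noise together sends the data point x to -x. Applied to one point of a pair,
it makes cross terms vanish. -/
theorem measurePreserving_latent_neg (d : ℕ) :
    MeasurePreserving (fun q : Bool × EuclideanSpace ℝ (Fin d) => (!q.1, -q.2))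
      (latentLaw d) (latentLaw d) := by
  refine MeasurePreserving.prod (f := fun b : Bool => !b)
    (g := fun x : EuclideanSpace ℝ (Fin d) => -x) ⟨measurable_of_finite _, ?_⟩
    ⟨by fun_prop, stdGaussian_map (LinearIsometryEquiv.neg ℝ)⟩
  simp [fairCoin, Measure.map_add _ _ (measurable_of_finite _),
    Measure.map_dirac, add_comm]

/-! ### Exponential domination, and mixed points in latent variables -/

/-- Exponential moment of the norm of a standard Gaussian vector. -/
noncomputable def gaussianExpMoment (d : ℕ) (t : ℝ) : ℝ :=
  ∫ x : EuclideanSpace ℝ (Fin d), Real.exp (t * ‖x‖) ∂(stdGaussian _)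

/-- Fernique's theorem gives an integrable exp(c‖x‖²), and t‖x‖ ≤ c‖x‖² + t²/(4c) by completing the
square. -/
theorem integrable_exp_norm_stdGaussian (d : ℕ) (t : ℝ) :
    Integrable (fun x : EuclideanSpace ℝ (Fin d) => Real.exp (t * ‖x‖)) (stdGaussian _) := by
  obtain ⟨c, hc, hint⟩ := IsGaussian.exists_integrable_exp_sq
    (stdGaussian (EuclideanSpace ℝ (Fin d)))
  refine (hint.const_mul (Real.exp (t ^ 2 / (4 * c)))).mono' (by fun_prop)
    (ae_of_all _ fun x => ?_)
  rw [Real.norm_of_nonneg (Real.exp_pos _).le, ← Real.exp_add]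
  refine Real.exp_le_exp.2 ?_
  have : t ^ 2 / (4 * c) + c * ‖x‖ ^ 2 - t * ‖x‖ = (t - 2 * c * ‖x‖) ^ 2 / (4 * c) := by
    field_simp; ring
  have : 0 ≤ (t - 2 * c * ‖x‖) ^ 2 / (4 * c) := by positivity
  linarith

theorem gaussianExpMoment_pos (d : ℕ) (t : ℝ) : 0 < gaussianExpMoment d t :=
  integral_exp_pos (integrable_exp_norm_stdGaussian d t)

/-- The dominating function `exp (t (‖G‖ + ‖G'‖))`. -/
noncomputable def noiseExp {d : ℕ} (t : ℝ)
    (q : (Bool × EuclideanSpace ℝ (Fin d)) × (Bool × EuclideanSpace ℝ (Fin d)) × I) : ℝ :=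
  Real.exp (t * ‖q.1.2‖) * Real.exp (t * ‖q.2.1.2‖)

theorem noiseExp_pos {d : ℕ} (t : ℝ)
    (q : (Bool × EuclideanSpace ℝ (Fin d)) × (Bool × EuclideanSpace ℝ (Fin d)) × I) :
    0 < noiseExp t q := by unfold noiseExp; positivity

theorem integrable_exp_norm_latent (d : ℕ) (t : ℝ) :
    Integrable (fun q : Bool × EuclideanSpace ℝ (Fin d) => Real.exp (t * ‖q.2‖)) (latentLaw d) :=
  (integrable_exp_norm_stdGaussian d t).comp_snd _

theorem integral_exp_norm_latent (d : ℕ) (t : ℝ) :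
    ∫ q, Real.exp (t * ‖q.2‖) ∂(latentLaw d) = gaussianExpMoment d t := by
  rw [latentLaw, integral_fun_snd (fun x => Real.exp (t * ‖x‖)), probReal_univ, one_smul]
  rfl

theorem integrable_noiseExp (d : ℕ) (L : Measure I) [IsProbabilityMeasure L] (t : ℝ) :
    Integrable (noiseExp t) (latentPairLaw d L) :=
  (integrable_exp_norm_latent d t).mul_prod ((integrable_exp_norm_latent d t).comp_fst L)

theorem integral_noiseExp (d : ℕ) (L : Measure I) [IsProbabilityMeasure L] (t : ℝ) :
    ∫ q, noiseExp t q ∂(latentPairLaw d L) = gaussianExpMoment d t ^ 2 := by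
  have h := integral_prod_mul (μ := latentLaw d) (ν := (latentLaw d).prod L)
    (fun q => Real.exp (t * ‖q.2‖)) (fun q => Real.exp (t * ‖q.1.2‖))
  unfold noiseExp latentPairLaw
  rw [h, integral_fun_fst (fun q : Bool × EuclideanSpace ℝ (Fin d) => Real.exp (t * ‖q.2‖)),
    integral_exp_norm_latent]
  simp [sq]

theorem integrable_of_le_noiseExp {d : ℕ} {L : Measure I} [IsProbabilityMeasure L]
    {f : (Bool × EuclideanSpace ℝ (Fin d)) × (Bool × EuclideanSpace ℝ (Fin d)) × I → ℝ}
    (hf : Measurable f) (K t : ℝ) (h : ∀ q, |f q| ≤ K * noiseExp t q) :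
    Integrable f (latentPairLaw d L) :=
  ((integrable_noiseExp d L t).const_mul K).mono' hf.aestronglyMeasurable
    (ae_of_all _ fun q => by rw [Real.norm_eq_abs]; exact h q)

/-- The latent variables of a pair of data points. -/
abbrev LatentPair (d : ℕ) : Type :=
  (Bool × EuclideanSpace ℝ (Fin d)) × (Bool × EuclideanSpace ℝ (Fin d)) × I

/-- The coefficient of the class mean in the mixed point. -/
noncomputable def mixedSign {d : ℕ} (g : I → I) (q : LatentPair d) : ℝ :=
  (g q.2.2 : ℝ) * boolSign q.1.1 + (1 - (g q.2.2 : ℝ)) * boolSign q.2.1.1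

/-- The noise of the mixed point. -/
noncomputable def mixedNoise {d : ℕ} (g : I → I) (q : LatentPair d) : EuclideanSpace ℝ (Fin d) :=
  (g q.2.2 : ℝ) • q.1.2 + (1 - (g q.2.2 : ℝ)) • q.2.1.2

@[fun_prop]
theorem measurable_mixedSign {d : ℕ} {g : I → I} (hg : Measurable g) :
    Measurable (mixedSign (d := d) g) := by
  unfold mixedSign; fun_prop

@[fun_prop]
theorem measurable_mixedNoise {d : ℕ} {g : I → I} (hg : Measurable g) :
    Measurable (mixedNoise (d := d) g) := by
  unfold mixedNoise; fun_prop

section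

variable {d : ℕ} (g : I → I) (m : EuclideanSpace ℝ (Fin d))
  (T : EuclideanSpace ℝ (Fin d) →L[ℝ] EuclideanSpace ℝ (Fin d))

theorem pairPoint_latentPair (q : LatentPair d) :
    pairPoint g (latentPair m T q) = mixedSign g q • m + T (mixedNoise g q) := by
  simp only [pairPoint, latentPair, latentPoint, mixedSign, mixedNoise, map_add, map_smul]
  module

theorem pairLabel_latentPair (q : LatentPair d) :
    pairLabel (latentPair m T q) =
      (1 + ((q.2.2 : ℝ) * boolSign q.1.1 + (1 - (q.2.2 : ℝ)) * boolSign q.2.1.1)) / 2 := by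
  simp only [pairLabel, latentPair, latentPoint]
  ring

theorem inner_pairPoint_latentPair (v : EuclideanSpace ℝ (Fin d)) (q : LatentPair d) :
    inner ℝ v (pairPoint g (latentPair m T q)) =
      (g q.2.2 : ℝ) * inner ℝ v (latentPoint m T q.1).1 +
        (1 - (g q.2.2 : ℝ)) * inner ℝ v (latentPoint m T q.2.1).1 := by
  simp only [pairPoint, latentPair, inner_add_right, inner_smul_right]

theorem pairLabel_latentPair_mem (q : LatentPair d) :
    0 ≤ pairLabel (latentPair m T q) ∧ pairLabel (latentPair m T q) ≤ 1 := by
  rw [pairLabel_latentPair]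
  have h1 := q.2.2.2.1
  have h2 := q.2.2.2.2
  have h3 := abs_le.1 (abs_boolSign q.1.1).le
  have h4 := abs_le.1 (abs_boolSign q.2.1.1).le
  constructor <;> nlinarith

theorem norm_pairPoint_le
    (q : (EuclideanSpace ℝ (Fin d) × ℝ) × (EuclideanSpace ℝ (Fin d) × ℝ) × I) :
    ‖pairPoint g q‖ ≤ ‖q.1.1‖ + ‖q.2.1.1‖ := by
  have h1 := (g q.2.2).2.1
  have h2 := (g q.2.2).2.2
  refine (norm_add_le _ _).trans ?_
  rw [norm_smul, norm_smul, Real.norm_of_nonneg h1, Real.norm_of_nonneg (by linarith)]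
  nlinarith [norm_nonneg q.1.1, norm_nonneg q.2.1.1]

variable {m T} {τ : ℝ} (hT : ∀ x, ‖T x‖ ≤ τ * ‖x‖)

include hT in
theorem norm_latentPoint_le (q : Bool × EuclideanSpace ℝ (Fin d)) :
    ‖(latentPoint m T q).1‖ ≤ ‖m‖ + τ * ‖q.2‖ := by
  refine (norm_add_le _ _).trans ?_
  rw [norm_smul, Real.norm_eq_abs, abs_boolSign, one_mul]
  linarith [hT q.2]

include hT in
theorem exp_norm_latentPair_le {t : ℝ} (ht : 0 ≤ t) (q : LatentPair d) :
    Real.exp (t * (‖(latentPair m T q).1.1‖ + ‖(latentPair m T q).2.1.1‖)) ≤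
      Real.exp (2 * t * ‖m‖) * noiseExp (t * τ) q := by
  rw [noiseExp, ← Real.exp_add, ← Real.exp_add]
  refine Real.exp_le_exp.2 ?_
  have h1 := mul_le_mul_of_nonneg_left (norm_latentPoint_le (m := m) hT q.1) ht
  have h2 := mul_le_mul_of_nonneg_left (norm_latentPoint_le (m := m) hT q.2.1) ht
  simp only [latentPair]
  nlinarith

end

/-- The noise does not contribute to expectations that are linear in the mixed point. -/
theorem integral_mul_inner_mixedNoise {d : ℕ} {L : Measure I} [IsProbabilityMeasure L] {g : I → I}
    (hg : Measurable g) (u : EuclideanSpace ℝ (Fin d)) {φ : Bool × Bool × I → ℝ}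
    (hφ : Measurable φ) :
    ∫ q, φ (q.1.1, q.2.1.1, q.2.2) * inner ℝ u (mixedNoise g q) ∂(latentPairLaw d L) = 0 := by
  have hR := measurePreserving_latent_isometry
    (LinearIsometryEquiv.neg ℝ (E := EuclideanSpace ℝ (Fin d)))
  refine integral_latentPairLaw_eq_zero hR hR (by fun_prop) fun q => ?_
  have : mixedNoise g ((q.1.1, -q.1.2), (q.2.1.1, -q.2.1.2), q.2.2) = -mixedNoise g q := by
    simp only [mixedNoise]; module
  simp only [LinearIsometryEquiv.coe_neg]
  rw [this, inner_neg_right, mul_neg]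

theorem abs_inner_mixedNoise_le {d : ℕ} (g : I → I) (u : EuclideanSpace ℝ (Fin d))
    (q : LatentPair d) : |inner ℝ u (mixedNoise g q)| ≤ ‖u‖ * noiseExp 1 q := by
  have h1 := (g q.2.2).2.1
  have h2 := (g q.2.2).2.2
  refine (abs_real_inner_le_norm _ _).trans (mul_le_mul_of_nonneg_left ?_ (norm_nonneg _))
  have h : ‖mixedNoise g q‖ ≤ ‖q.1.2‖ + ‖q.2.1.2‖ := by
    refine (norm_add_le _ _).trans ?_
    rw [norm_smul, norm_smul, Real.norm_of_nonneg h1, Real.norm_of_nonneg (by linarith)]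
    nlinarith [norm_nonneg q.1.2, norm_nonneg q.2.1.2]
  rw [noiseExp, ← Real.exp_add]
  have := Real.add_one_le_exp (1 * ‖q.1.2‖ + 1 * ‖q.2.1.2‖)
  linarith

theorem abs_mixedSign_le {d : ℕ} (g : I → I) (q : LatentPair d) : |mixedSign g q| ≤ 1 := by
  have h1 := (g q.2.2).2.1
  have h2 := (g q.2.2).2.2
  have h3 := abs_le.1 (abs_boolSign q.1.1).le
  have h4 := abs_le.1 (abs_boolSign q.2.1.1).le
  rw [mixedSign, abs_le]
  constructor <;> nlinarith

theorem integrable_of_bounded_latent {d : ℕ} {L : Measure I} [IsProbabilityMeasure L]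
    {f : LatentPair d → ℝ} (hf : Measurable f) {K : ℝ} (h : ∀ q, |f q| ≤ K) :
    Integrable f (latentPairLaw d L) :=
  Integrable.of_bound hf.aestronglyMeasurable K (ae_of_all _ fun q => by
    rw [Real.norm_eq_abs]; exact h q)

/-- The weight φ sees only classes and mixing coefficient, so the noise part is odd under negation
of both noises and only the multiple of m survives. It evaluates the radial gradient at slope 0 and
bounds it at large slopes. -/
theorem integral_mul_inner_pairPoint {d : ℕ} {L : Measure I} [IsProbabilityMeasure L] {g : I → I}
    (hg : Measurable g) (m : EuclideanSpace ℝ (Fin d))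
    {T : EuclideanSpace ℝ (Fin d) →L[ℝ] EuclideanSpace ℝ (Fin d)}
    (hT : ∀ x y, inner ℝ x (T y) = inner ℝ (T x) y)
    (v : EuclideanSpace ℝ (Fin d)) {φ : Bool × Bool × I → ℝ} (hφ : Measurable φ)
    (hφ1 : ∀ x, |φ x| ≤ 1) :
    Integrable (fun q => φ (q.1.1, q.2.1.1, q.2.2) * inner ℝ v (pairPoint g (latentPair m T q)))
      (latentPairLaw d L) ∧
    ∫ q, φ (q.1.1, q.2.1.1, q.2.2) * inner ℝ v (pairPoint g (latentPair m T q))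
      ∂(latentPairLaw d L) =
    (∫ q : LatentPair d, φ (q.1.1, q.2.1.1, q.2.2) * mixedSign g q ∂(latentPairLaw d L)) *
      inner ℝ v m := by
  have h : ∀ q : LatentPair d,
      φ (q.1.1, q.2.1.1, q.2.2) * inner ℝ v (pairPoint g (latentPair m T q)) =
      φ (q.1.1, q.2.1.1, q.2.2) * mixedSign g q * inner ℝ v m +
        φ (q.1.1, q.2.1.1, q.2.2) * inner ℝ (T v) (mixedNoise g q) := fun q => by
    rw [pairPoint_latentPair, inner_add_right, inner_smul_right, hT]; ring
  have i1 : Integrable (fun q : LatentPair d =>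
      φ (q.1.1, q.2.1.1, q.2.2) * mixedSign g q * inner ℝ v m) (latentPairLaw d L) := by
    refine (integrable_of_bounded_latent (K := 1) (by fun_prop) fun q => ?_).mul_const _
    rw [abs_mul]
    exact mul_le_one₀ (hφ1 _) (abs_nonneg _) (abs_mixedSign_le g q)
  have i2 : Integrable (fun q : LatentPair d =>
      φ (q.1.1, q.2.1.1, q.2.2) * inner ℝ (T v) (mixedNoise g q)) (latentPairLaw d L) := by
    refine integrable_of_le_noiseExp (by fun_prop) ‖T v‖ 1 fun q => ?_
    rw [abs_mul]
    exact (mul_le_of_le_one_left (abs_nonneg _) (hφ1 _)).trans (abs_inner_mixedNoise_le g (T v) q)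
  simp_rw [h]
  refine ⟨i1.add i2, ?_⟩
  rw [integral_add i1 i2, integral_mul_inner_mixedNoise hg _ hφ, add_zero, integral_mul_const]

/-- By symmetry, the population gradient at a multiple of `θ` vanishes in the directions that are
orthogonal to the class mean and conjugate to `θ`. -/
theorem integral_sigmoid_sub_mul_inner_eq_zero {d : ℕ} {L : Measure I} [IsProbabilityMeasure L]
    {g : I → I} (hg : Measurable g) (m θ : EuclideanSpace ℝ (Fin d))
    {T : EuclideanSpace ℝ (Fin d) →L[ℝ] EuclideanSpace ℝ (Fin d)}
    (hT : ∀ x y, inner ℝ x (T y) = inner ℝ (T x) y)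
    (v : EuclideanSpace ℝ (Fin d)) (hv : inner ℝ v m = (0 : ℝ))
    (hTv : inner ℝ (T v) (T θ) = (0 : ℝ)) (c : ℝ) :
    ∫ q, (Real.sigmoid (c * inner ℝ θ (pairPoint g (latentPair m T q))) -
      pairLabel (latentPair m T q)) * inner ℝ v (pairPoint g (latentPair m T q))
      ∂(latentPairLaw d L) = 0 := by
  -- The reflection in the hyperplane orthogonal to Tv is applied to both noises. It fixes Tθ by
  -- conjugacy, so slopes along θ and labels are unchanged; the component along v changes sign
  -- because v ⟂ m.
  let R : EuclideanSpace ℝ (Fin d) ≃ₗᵢ[ℝ] EuclideanSpace ℝ (Fin d) := (ℝ ∙ T v)ᗮ.reflection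
  have hRs : ∀ x y, inner ℝ x (R y) = inner ℝ (R x) y := fun x y => by
    have h : R (R y) = y := Submodule.reflection_reflection _ y
    rw [← R.inner_map_map x, h]
  have hR1 : R (T v) = -T v := Submodule.reflection_orthogonalComplement_singleton_eq_neg _
  have hR2 : R (T θ) = T θ := by
    refine Submodule.reflection_mem_subspace_eq_self ?_
    exact Submodule.mem_orthogonal_singleton_iff_inner_right.2 hTv
  have hψ := measurePreserving_latent_isometry R
  have hsig := continuous_sigmoid.measurable
  refine integral_latentPairLaw_eq_zero hψ hψ (by fun_prop) fun q => ?_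
  set q' : LatentPair d := ((q.1.1, R q.1.2), (q.2.1.1, R q.2.1.2), q.2.2) with hq'
  have e0 : mixedNoise g q' = R (mixedNoise g q) := by
    simp only [mixedNoise, hq', map_add, map_smul]
  have e1 : inner ℝ θ (pairPoint g (latentPair m T q')) =
      inner ℝ θ (pairPoint g (latentPair m T q)) := by
    rw [pairPoint_latentPair, pairPoint_latentPair, inner_add_right, inner_add_right, e0, hT, hRs,
      hR2, hT]
    rfl
  have e2 : inner ℝ v (pairPoint g (latentPair m T q')) =
      -inner ℝ v (pairPoint g (latentPair m T q)) := by
    rw [pairPoint_latentPair, pairPoint_latentPair, inner_add_right, inner_add_right, e0, hT, hRs,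
      hR1, hT, inner_smul_right, inner_smul_right, hv, inner_neg_left]
    ring
  have e3 : pairLabel (latentPair m T q') = pairLabel (latentPair m T q) := by
    rw [pairLabel_latentPair, pairLabel_latentPair]
  rw [e1, e2, e3, mul_neg]

/-! ### Second moments of the mixed points and curvature -/

theorem sq_inner_latentPoint_le {d : ℕ} (m : EuclideanSpace ℝ (Fin d))
    {T : EuclideanSpace ℝ (Fin d) →L[ℝ] EuclideanSpace ℝ (Fin d)}
    (hT : ∀ x y, inner ℝ x (T y) = inner ℝ (T x) y) (v : EuclideanSpace ℝ (Fin d))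
    (q : Bool × EuclideanSpace ℝ (Fin d)) :
    (inner ℝ v (latentPoint m T q).1 : ℝ) ^ 2 ≤
      4 * ((inner ℝ v m) ^ 2 + ‖T v‖ ^ 2) * Real.exp ‖q.2‖ := by
  rw [latentPoint, inner_add_right, inner_smul_right, hT]
  have h1 := boolSign_sq q.1
  have h2 : (inner ℝ (T v) q.2 : ℝ) ^ 2 ≤ ‖T v‖ ^ 2 * ‖q.2‖ ^ 2 := by
    rw [← mul_pow]; exact sq_le_sq' (neg_le_of_abs_le (abs_real_inner_le_norm _ _))
      (real_inner_le_norm _ _)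
  have h3 : 1 + ‖q.2‖ ^ 2 ≤ 2 * Real.exp ‖q.2‖ := by
    have := Real.quadratic_le_exp_of_nonneg (norm_nonneg q.2)
    nlinarith [norm_nonneg q.2]
  have h4 : (boolSign q.1 * inner ℝ v m + inner ℝ (T v) q.2) ^ 2 ≤
      2 * ((inner ℝ v m) ^ 2 + (inner ℝ (T v) q.2) ^ 2) := by
    have := sq_nonneg (boolSign q.1 * inner ℝ v m - inner ℝ (T v) q.2)
    have e : (boolSign q.1 * inner ℝ v m) ^ 2 = (inner ℝ v m) ^ 2 := by rw [mul_pow, h1, one_mul]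
    nlinarith
  have h5 := mul_le_mul_of_nonneg_left h3
    (by positivity : 0 ≤ (inner ℝ v m : ℝ) ^ 2 + ‖T v‖ ^ 2)
  nlinarith [sq_nonneg (inner ℝ v m : ℝ), sq_nonneg ‖T v‖, sq_nonneg ‖q.2‖,
    mul_nonneg (sq_nonneg (inner ℝ v m : ℝ)) (sq_nonneg ‖q.2‖)]

/-- Convexity of the square reduces to the two unmixed points. The prefactor is, up to the 4, the
exact second moment of the data along v, so this bound and the lower bound on the mean differ by a
constant free of v and T. -/
theorem sq_inner_pairPoint_le {d : ℕ} (g : I → I) (m : EuclideanSpace ℝ (Fin d))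
    {T : EuclideanSpace ℝ (Fin d) →L[ℝ] EuclideanSpace ℝ (Fin d)}
    (hT : ∀ x y, inner ℝ x (T y) = inner ℝ (T x) y) (v : EuclideanSpace ℝ (Fin d))
    (q : LatentPair d) :
    (inner ℝ v (pairPoint g (latentPair m T q)) : ℝ) ^ 2 ≤
      4 * ((inner ℝ v m) ^ 2 + ‖T v‖ ^ 2) * noiseExp 1 q := by
  rw [inner_pairPoint_latentPair]
  have h1 := (g q.2.2).2.1
  have h2 := (g q.2.2).2.2
  have h3 := sq_inner_latentPoint_le m hT v q.1
  have h4 := sq_inner_latentPoint_le m hT v q.2.1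
  have h5 : Real.exp ‖q.1.2‖ ≤ noiseExp 1 q := by
    rw [noiseExp, one_mul, one_mul]
    exact le_mul_of_one_le_right (Real.exp_pos _).le (Real.one_le_exp (norm_nonneg _))
  have h6 : Real.exp ‖q.2.1.2‖ ≤ noiseExp 1 q := by
    rw [noiseExp, one_mul, one_mul]
    exact le_mul_of_one_le_left (Real.exp_pos _).le (Real.one_le_exp (norm_nonneg _))
  have hN : 0 ≤ 4 * ((inner ℝ v m : ℝ) ^ 2 + ‖T v‖ ^ 2) := by positivity
  have h7 := h3.trans (mul_le_mul_of_nonneg_left h5 hN)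
  have h8 := h4.trans (mul_le_mul_of_nonneg_left h6 hN)
  set a : ℝ := inner ℝ v (latentPoint m T q.1).1
  set b : ℝ := inner ℝ v (latentPoint m T q.2.1).1
  set t : ℝ := (g q.2.2 : ℝ)
  have h9 : (t * a + (1 - t) * b) ^ 2 ≤ t * a ^ 2 + (1 - t) * b ^ 2 := by
    nlinarith [mul_nonneg (mul_nonneg h1 (sub_nonneg.2 h2)) (sq_nonneg (a - b))]
  nlinarith [mul_le_mul_of_nonneg_left h7 h1, mul_le_mul_of_nonneg_left h8 (sub_nonneg.2 h2)]

theorem integral_sq_inner_stdGaussian {d : ℕ} (u : EuclideanSpace ℝ (Fin d)) :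
    ∫ x, (inner ℝ u x : ℝ) ^ 2 ∂(stdGaussian (EuclideanSpace ℝ (Fin d))) = ‖u‖ ^ 2 := by
  have h := variance_dual_stdGaussian (innerSL ℝ u)
  rw [variance_of_integral_eq_zero (by fun_prop) (integral_strongDual_stdGaussian _)] at h
  simpa using h

/-- The second moment of the data in a direction. -/
theorem integral_sq_inner_latentPoint {d : ℕ} (m : EuclideanSpace ℝ (Fin d))
    {T : EuclideanSpace ℝ (Fin d) →L[ℝ] EuclideanSpace ℝ (Fin d)}
    (hT : ∀ x y, inner ℝ x (T y) = inner ℝ (T x) y) (v : EuclideanSpace ℝ (Fin d)) :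
    ∫ q, (inner ℝ v (latentPoint m T q).1 : ℝ) ^ 2 ∂(latentLaw d) =
      (inner ℝ v m) ^ 2 + ‖T v‖ ^ 2 := by
  have h : ∀ q : Bool × EuclideanSpace ℝ (Fin d), (inner ℝ v (latentPoint m T q).1 : ℝ) ^ 2 =
      ((inner ℝ v m) ^ 2 + (2 * inner ℝ v m * boolSign q.1) * inner ℝ (T v) q.2) +
        (inner ℝ (T v) q.2) ^ 2 := fun q => by
    rw [latentPoint, inner_add_right, inner_smul_right, hT]
    have := boolSign_sq q.1
    linear_combination (inner ℝ v m) ^ 2 * this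
  have i0 : Integrable (fun x : EuclideanSpace ℝ (Fin d) => (inner ℝ (T v) x : ℝ))
      (stdGaussian _) := by
    have := (innerSL ℝ (T v)).integrable_comp
      (IsGaussian.integrable_id (μ := stdGaussian (EuclideanSpace ℝ (Fin d))))
    simpa using this
  have i0' : Integrable (fun x : EuclideanSpace ℝ (Fin d) => (inner ℝ (T v) x : ℝ) ^ 2)
      (stdGaussian _) := by
    have := (innerSL ℝ (T v)).comp_memLp'
      (IsGaussian.memLp_two_id (μ := stdGaussian (EuclideanSpace ℝ (Fin d))))
    simpa using this.integrable_sq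
  have i1 : Integrable (fun q : Bool × EuclideanSpace ℝ (Fin d) =>
      (2 * inner ℝ v m * boolSign q.1) * inner ℝ (T v) q.2) (latentLaw d) :=
    Integrable.mul_prod (f := fun b => 2 * inner ℝ v m * boolSign b)
      (Integrable.of_finite) i0
  have i2 : Integrable (fun q : Bool × EuclideanSpace ℝ (Fin d) =>
      (inner ℝ (T v) q.2 : ℝ) ^ 2) (latentLaw d) := i0'.comp_snd _
  have e1 : ∫ q, (2 * inner ℝ v m * boolSign q.1) * inner ℝ (T v) q.2 ∂(latentLaw d) = 0 := by
    rw [latentLaw, integral_prod_mul (fun b => 2 * inner ℝ v m * boolSign b)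
      (fun x : EuclideanSpace ℝ (Fin d) => (inner ℝ (T v) x : ℝ))]
    have := integral_strongDual_stdGaussian (innerSL ℝ (T v))
    simp only [innerSL_apply_apply] at this
    rw [this, mul_zero]
  have e2 : ∫ q, (inner ℝ (T v) q.2 : ℝ) ^ 2 ∂(latentLaw d) = ‖T v‖ ^ 2 := by
    rw [latentLaw, integral_fun_snd (fun x => (inner ℝ (T v) x : ℝ) ^ 2), probReal_univ, one_smul,
      integral_sq_inner_stdGaussian]
  simp_rw [h]
  rw [integral_add (f := fun q : Bool × EuclideanSpace ℝ (Fin d) => (inner ℝ v m) ^ 2 +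
    (2 * inner ℝ v m * boolSign q.1) * inner ℝ (T v) q.2) ((integrable_const _).add i1) i2,
    integral_add (integrable_const _) i1, e1, e2]
  simp

/-- The cross term of the square vanishes on flipping one of the two points, and the squares leave
the second moment times E[g² + (1 - g)²], which is at least 1/2. -/
theorem half_le_integral_sq_inner_pairPoint {d : ℕ} {L : Measure I} [IsProbabilityMeasure L]
    {g : I → I} (hg : Measurable g) (m : EuclideanSpace ℝ (Fin d))
    {T : EuclideanSpace ℝ (Fin d) →L[ℝ] EuclideanSpace ℝ (Fin d)}
    (hT : ∀ x y, inner ℝ x (T y) = inner ℝ (T x) y) (v : EuclideanSpace ℝ (Fin d)) :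
    ((inner ℝ v m) ^ 2 + ‖T v‖ ^ 2) / 2 ≤
      ∫ q, (inner ℝ v (pairPoint g (latentPair m T q)) : ℝ) ^ 2 ∂(latentPairLaw d L) := by
  set N := (inner ℝ v m : ℝ) ^ 2 + ‖T v‖ ^ 2 with hN
  have hN0 : 0 ≤ N := by positivity
  let X : Bool × EuclideanSpace ℝ (Fin d) → ℝ := fun q => inner ℝ v (latentPoint m T q).1
  have hX : Measurable X := by fun_prop
  have hXneg : ∀ q, X (!q.1, -q.2) = -X q := fun q => by
    simp only [X, latentPoint, boolSign_not, map_neg, ← inner_neg_right]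
    congr 1
    module
  have hX2 : Integrable (fun q => X q ^ 2) (latentLaw d) := by
    refine ((integrable_exp_norm_latent d 1).const_mul (4 * N)).mono' (by fun_prop)
      (ae_of_all _ fun q => ?_)
    rw [Real.norm_of_nonneg (sq_nonneg _), one_mul]
    exact sq_inner_latentPoint_le m hT v q
  have hcross : ∫ q : LatentPair d, 2 * (g q.2.2 : ℝ) * (1 - (g q.2.2 : ℝ)) * X q.1 * X q.2.1
      ∂(latentPairLaw d L) = 0 := by
    refine integral_latentPairLaw_eq_zero (measurePreserving_latent_neg d)
      (MeasurePreserving.id _) (by fun_prop) fun q => ?_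
    simp only [hXneg, id]
    ring
  have hg01 : ∀ l, 0 ≤ (g l : ℝ) ∧ (g l : ℝ) ≤ 1 := fun l => ⟨(g l).2.1, (g l).2.2⟩
  have ig : ∀ {f : I → ℝ}, Measurable f → (∀ l, 0 ≤ f l ∧ f l ≤ 1) → Integrable f L := by
    intro f hf h
    refine Integrable.of_bound hf.aestronglyMeasurable 1 (ae_of_all _ fun l => ?_)
    rw [Real.norm_of_nonneg (h l).1]; exact (h l).2
  have ig1 : Integrable (fun l => (g l : ℝ) ^ 2) L :=
    ig (by fun_prop) fun l => ⟨sq_nonneg _, pow_le_one₀ (hg01 l).1 (hg01 l).2⟩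
  have ig2 : Integrable (fun l => (1 - (g l : ℝ)) ^ 2) L :=
    ig (by fun_prop) fun l => ⟨sq_nonneg _, pow_le_one₀ (by linarith [(hg01 l).2])
      (by linarith [(hg01 l).1])⟩
  have i1 : Integrable (fun q : LatentPair d => X q.1 ^ 2 * (g q.2.2 : ℝ) ^ 2)
      (latentPairLaw d L) := hX2.mul_prod (ig1.comp_snd (latentLaw d))
  have i2' : Integrable (fun q : (Bool × EuclideanSpace ℝ (Fin d)) × I =>
      X q.1 ^ 2 * (1 - (g q.2 : ℝ)) ^ 2) ((latentLaw d).prod L) := hX2.mul_prod ig2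
  have i2 : Integrable (fun q : LatentPair d => X q.2.1 ^ 2 * (1 - (g q.2.2 : ℝ)) ^ 2)
      (latentPairLaw d L) := i2'.comp_snd _
  have e1 : ∫ q : LatentPair d, X q.1 ^ 2 * (g q.2.2 : ℝ) ^ 2 ∂(latentPairLaw d L) =
      N * ∫ l, (g l : ℝ) ^ 2 ∂L := by
    rw [latentPairLaw, integral_prod_mul (fun q => X q ^ 2)
      (fun q : (Bool × EuclideanSpace ℝ (Fin d)) × I => (g q.2 : ℝ) ^ 2),
      integral_sq_inner_latentPoint m hT v, integral_fun_snd (fun l => (g l : ℝ) ^ 2)]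
    simp [hN]
  have e2 : ∫ q : LatentPair d, X q.2.1 ^ 2 * (1 - (g q.2.2 : ℝ)) ^ 2 ∂(latentPairLaw d L) =
      N * ∫ l, (1 - (g l : ℝ)) ^ 2 ∂L := by
    rw [latentPairLaw, integral_fun_snd (fun q : (Bool × EuclideanSpace ℝ (Fin d)) × I =>
      X q.1 ^ 2 * (1 - (g q.2 : ℝ)) ^ 2), integral_prod_mul (fun q => X q ^ 2)
      (fun l => (1 - (g l : ℝ)) ^ 2), integral_sq_inner_latentPoint m hT v]
    simp [hN]
  have itot : Integrable (fun q : LatentPair d =>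
      (inner ℝ v (pairPoint g (latentPair m T q)) : ℝ) ^ 2) (latentPairLaw d L) := by
    refine integrable_of_le_noiseExp (by fun_prop) (4 * N) 1 fun q => ?_
    rw [abs_of_nonneg (sq_nonneg _)]
    exact sq_inner_pairPoint_le g m hT v q
  have hsplit : ∀ q : LatentPair d, (inner ℝ v (pairPoint g (latentPair m T q)) : ℝ) ^ 2 -
      X q.1 ^ 2 * (g q.2.2 : ℝ) ^ 2 - X q.2.1 ^ 2 * (1 - (g q.2.2 : ℝ)) ^ 2 =
      2 * (g q.2.2 : ℝ) * (1 - (g q.2.2 : ℝ)) * X q.1 * X q.2.1 := fun q => by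
    rw [inner_pairPoint_latentPair]; simp only [X]; ring
  simp_rw [← hsplit] at hcross
  rw [integral_sub (f := fun q : LatentPair d =>
      (inner ℝ v (pairPoint g (latentPair m T q)) : ℝ) ^ 2 - X q.1 ^ 2 * (g q.2.2 : ℝ) ^ 2)
      (itot.sub i1) i2, integral_sub itot i1, e1, e2] at hcross
  have hgg : 1 / 2 ≤ ∫ l, (g l : ℝ) ^ 2 ∂L + ∫ l, (1 - (g l : ℝ)) ^ 2 ∂L := by
    rw [← integral_add ig1 ig2]
    have : ∫ _l : I, (1 / 2 : ℝ) ∂L ≤ ∫ l, ((g l : ℝ) ^ 2 + (1 - (g l : ℝ)) ^ 2) ∂L :=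
      integral_mono (integrable_const _) (ig1.add ig2) fun l => by
        nlinarith [sq_nonneg ((g l : ℝ) - 1 / 2)]
    simpa using this
  nlinarith [mul_le_mul_of_nonneg_left hgg hN0]

/-- Lower bound for the weighted second moment of the mixed points. -/
theorem exists_le_integral_exp_mul_sq_inner {d : ℕ} (L : Measure I) [IsProbabilityMeasure L]
    {g : I → I} (hg : Measurable g) (m : EuclideanSpace ℝ (Fin d)) {τ W : ℝ} (hW : 0 ≤ W) :
    ∃ c : ℝ, 0 < c ∧ ∀ T : EuclideanSpace ℝ (Fin d) →L[ℝ] EuclideanSpace ℝ (Fin d),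
      (∀ x y, inner ℝ x (T y) = inner ℝ (T x) y) → (∀ x, ‖T x‖ ≤ τ * ‖x‖) → ∀ v,
      c * ‖T v‖ ^ 2 ≤ ∫ q, Real.exp (-(W * ‖pairPoint g (latentPair m T q)‖)) *
        (inner ℝ v (pairPoint g (latentPair m T q)) : ℝ) ^ 2 ∂(latentPairLaw d L) := by
  set t := W * τ + 1 with ht
  set B := 4 * Real.exp (2 * W * ‖m‖) * gaussianExpMoment d t ^ 2 with hB
  have hB0 : 0 < B := by
    have := gaussianExpMoment_pos d t
    positivity
  refine ⟨1 / (4 * B), by positivity, fun T hT hTτ v => ?_⟩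
  set N := (inner ℝ v m : ℝ) ^ 2 + ‖T v‖ ^ 2 with hN
  have hN0 : 0 ≤ N := by positivity
  -- With E = exp(W‖x‖), the tangent bound 1/E ≥ 2s - s²E reduces the weighted moment to a lower
  -- bound N/2 on the plain moment and an upper bound BN on the moment weighted by E. The resulting
  -- sN - s²BN is largest at this s, with value N/(4B).
  set s := 1 / (2 * B) with hs
  have hs0 : 0 < s := by positivity
  let P : LatentPair d → EuclideanSpace ℝ (Fin d) := fun q => pairPoint g (latentPair m T q)
  have hP : Measurable P := by fun_prop
  have hup : ∀ q, Real.exp (W * ‖P q‖) * (inner ℝ v (P q) : ℝ) ^ 2 ≤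
      4 * N * Real.exp (2 * W * ‖m‖) * noiseExp t q := by
    intro q
    have h1 := sq_inner_pairPoint_le g m hT v q
    have h2 : Real.exp (W * ‖P q‖) ≤ Real.exp (2 * W * ‖m‖) * noiseExp (W * τ) q := by
      refine le_trans ?_ (exp_norm_latentPair_le hTτ hW q)
      exact Real.exp_le_exp.2 (mul_le_mul_of_nonneg_left (norm_pairPoint_le g _) hW)
    have h3 : noiseExp (W * τ) q * noiseExp 1 q = noiseExp t q := by
      simp only [noiseExp, ← Real.exp_add, ht]; ring_nf
    calc _ ≤ (Real.exp (2 * W * ‖m‖) * noiseExp (W * τ) q) * (4 * N * noiseExp 1 q) :=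
          mul_le_mul h2 h1 (sq_nonneg _) (by have := noiseExp_pos (W * τ) q; positivity)
      _ = 4 * N * Real.exp (2 * W * ‖m‖) * (noiseExp (W * τ) q * noiseExp 1 q) := by ring
      _ = _ := by rw [h3]
  have i1 : Integrable (fun q => (inner ℝ v (P q) : ℝ) ^ 2) (latentPairLaw d L) := by
    refine integrable_of_le_noiseExp (by fun_prop) (4 * N) 1 fun q => ?_
    rw [abs_of_nonneg (sq_nonneg _)]
    exact sq_inner_pairPoint_le g m hT v q
  have i2 : Integrable (fun q => Real.exp (W * ‖P q‖) * (inner ℝ v (P q) : ℝ) ^ 2)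
      (latentPairLaw d L) := by
    refine integrable_of_le_noiseExp (by fun_prop)
      (4 * N * Real.exp (2 * W * ‖m‖)) t fun q => ?_
    rw [abs_of_nonneg (by positivity)]
    exact hup q
  have i3 : Integrable (fun q => Real.exp (-(W * ‖P q‖)) * (inner ℝ v (P q) : ℝ) ^ 2)
      (latentPairLaw d L) := by
    refine i1.mono' (by fun_prop) (ae_of_all _ fun q => ?_)
    rw [Real.norm_of_nonneg (by positivity)]
    refine mul_le_of_le_one_left (sq_nonneg _) (Real.exp_le_one_iff.2 ?_)
    have := mul_nonneg hW (norm_nonneg (P q))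
    linarith
  have hup' : ∫ q, Real.exp (W * ‖P q‖) * (inner ℝ v (P q) : ℝ) ^ 2 ∂(latentPairLaw d L) ≤
      B * N := by
    calc _ ≤ ∫ q, 4 * N * Real.exp (2 * W * ‖m‖) * noiseExp t q ∂(latentPairLaw d L) :=
          integral_mono i2 ((integrable_noiseExp d L t).const_mul _) hup
      _ = _ := by rw [integral_const_mul, integral_noiseExp, hB]; ring
  have hlow := half_le_integral_sq_inner_pairPoint (L := L) hg m hT v
  have hmain : ∫ q, (2 * s * (inner ℝ v (P q) : ℝ) ^ 2 -
      s ^ 2 * (Real.exp (W * ‖P q‖) * (inner ℝ v (P q) : ℝ) ^ 2)) ∂(latentPairLaw d L) ≤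
      ∫ q, Real.exp (-(W * ‖P q‖)) * (inner ℝ v (P q) : ℝ) ^ 2 ∂(latentPairLaw d L) := by
    refine integral_mono ((i1.const_mul _).sub (i2.const_mul _)) i3 fun q => ?_
    set E := Real.exp (W * ‖P q‖) with hE
    have hE0 : 0 < E := Real.exp_pos _
    have hEi : Real.exp (-(W * ‖P q‖)) = E⁻¹ := Real.exp_neg _
    have : E⁻¹ - 2 * s + s ^ 2 * E = E⁻¹ * (1 - s * E) ^ 2 := by field_simp; ring
    have h0 : 0 ≤ (E⁻¹ * (1 - s * E) ^ 2) * (inner ℝ v (P q) : ℝ) ^ 2 := by positivity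
    simp only [hEi]
    rw [← this] at h0
    linarith
  rw [integral_sub (i1.const_mul _) (i2.const_mul _), integral_const_mul, integral_const_mul]
    at hmain
  refine le_trans ?_ hmain
  have h1 : 2 * s * (N / 2) ≤
      2 * s * ∫ q, (inner ℝ v (P q) : ℝ) ^ 2 ∂(latentPairLaw d L) :=
    mul_le_mul_of_nonneg_left hlow (by positivity)
  have h2 := mul_le_mul_of_nonneg_left hup' (sq_nonneg s)
  have h3 : 2 * s * (N / 2) - s ^ 2 * (B * N) = 1 / (4 * B) * N := by
    rw [hs]; field_simp; ring
  have h4 : 1 / (4 * B) * ‖T v‖ ^ 2 ≤ 1 / (4 * B) * N := by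
    refine mul_le_mul_of_nonneg_left ?_ (by positivity)
    rw [hN]; linarith [sq_nonneg (inner ℝ v m : ℝ)]
  linarith

/-! ### Radial component of the population gradient -/

theorem abs_sigmoid_sub_le (a b : ℝ) : |Real.sigmoid a - Real.sigmoid b| ≤ |a - b| := by
  have h := Convex.norm_image_sub_le_of_norm_hasDerivWithin_le (f := Real.sigmoid)
    (f' := fun x => Real.sigmoid x * (1 - Real.sigmoid x)) (s := Set.univ) (C := 1) (x := b) (y := a)
    (fun x _ => (Real.hasDerivAt_sigmoid x).hasDerivWithinAt)
    (fun x _ => by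
      have h1 := Real.sigmoid_nonneg x
      have h2 := Real.sigmoid_le_one x
      rw [Real.norm_of_nonneg (mul_nonneg h1 (by linarith))]
      nlinarith) convex_univ (Set.mem_univ _) (Set.mem_univ _)
  simpa using h

theorem sigmoid_le_exp (x : ℝ) : Real.sigmoid x ≤ Real.exp x := by
  have h := Real.sigmoid_mul_rexp_neg (-x)
  rw [neg_neg] at h
  rw [← h]
  exact mul_le_of_le_one_left (Real.exp_pos _).le (Real.sigmoid_le_one _)

/-- For a large slope, the gradient of the loss in the direction of the point is essentially
`(1 - y) z⁺ + y z⁻`. -/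
theorem min_mul_abs_sub_le {c z y : ℝ} (hc : 0 < c) :
    min y (1 - y) * |z| - 1 / c ≤ (Real.sigmoid (c * z) - y) * z := by
  -- On the wrong side of the margin σ(-cx) ≤ exp(-cx), and cx exp(-cx) ≤ 1: this is the only error
  -- made.
  have key : ∀ x : ℝ, 0 ≤ x → Real.sigmoid (-(c * x)) * x ≤ 1 / c := by
    intro x hx
    rw [le_div_iff₀ hc]
    have h1 : Real.sigmoid (-(c * x)) ≤ Real.exp (-(c * x)) := sigmoid_le_exp _
    have h2 : c * x ≤ Real.exp (c * x) := by linarith [Real.add_one_le_exp (c * x)]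
    have h3 : Real.exp (-(c * x)) * Real.exp (c * x) = 1 := by rw [← Real.exp_add]; simp
    have h4 : 0 ≤ c * x := by positivity
    calc Real.sigmoid (-(c * x)) * x * c = Real.sigmoid (-(c * x)) * (c * x) := by ring
      _ ≤ Real.exp (-(c * x)) * Real.exp (c * x) :=
        mul_le_mul h1 h2 h4 (Real.exp_pos _).le
      _ = 1 := h3
  rcases le_or_gt 0 z with hz | hz
  · rw [abs_of_nonneg hz]
    have h1 := key z hz
    rw [Real.sigmoid_neg] at h1
    have h2 : min y (1 - y) * z ≤ (1 - y) * z := mul_le_mul_of_nonneg_right (min_le_right _ _) hz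
    nlinarith
  · rw [abs_of_neg hz]
    have h1 := key (-z) (by linarith)
    rw [mul_neg, mul_neg, neg_neg] at h1
    have h2 : min y (1 - y) * -z ≤ y * -z :=
      mul_le_mul_of_nonneg_right (min_le_left _ _) (by linarith)
    nlinarith

/-- The radial component of the population gradient. -/
noncomputable def radialGradient {d : ℕ} (g : I → I) (L : Measure I)
    (m θ : EuclideanSpace ℝ (Fin d)) (T : EuclideanSpace ℝ (Fin d) →L[ℝ] EuclideanSpace ℝ (Fin d))
    (c : ℝ) : ℝ :=
  ∫ q, (Real.sigmoid (c * inner ℝ θ (pairPoint g (latentPair m T q))) -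
      pairLabel (latentPair m T q)) * inner ℝ θ (pairPoint g (latentPair m T q))
      ∂(latentPairLaw d L)

section

variable {d : ℕ} {L : Measure I} [IsProbabilityMeasure L] {g : I → I} (hg : Measurable g)
  (m θ : EuclideanSpace ℝ (Fin d))
  {T : EuclideanSpace ℝ (Fin d) →L[ℝ] EuclideanSpace ℝ (Fin d)}
  (hT : ∀ x y, inner ℝ x (T y) = inner ℝ (T x) y)

include hg hT

theorem integrable_sq_inner_pairPoint : Integrable (fun q =>
    (inner ℝ θ (pairPoint g (latentPair m T q)) : ℝ) ^ 2) (latentPairLaw d L) := by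
  refine integrable_of_le_noiseExp (by fun_prop)
    (4 * ((inner ℝ θ m) ^ 2 + ‖T θ‖ ^ 2)) 1 fun q => ?_
  rw [abs_of_nonneg (sq_nonneg _)]
  exact sq_inner_pairPoint_le g m hT θ q

theorem integral_sq_inner_pairPoint_le :
    ∫ q, (inner ℝ θ (pairPoint g (latentPair m T q)) : ℝ) ^ 2 ∂(latentPairLaw d L) ≤
      4 * ((inner ℝ θ m) ^ 2 + ‖T θ‖ ^ 2) * gaussianExpMoment d 1 ^ 2 := by
  rw [← integral_noiseExp d L, ← integral_const_mul]
  exact integral_mono (integrable_sq_inner_pairPoint hg m θ hT)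
    ((integrable_noiseExp d L 1).const_mul _) fun q => sq_inner_pairPoint_le g m hT θ q

theorem integrable_radialGradient (c : ℝ) : Integrable (fun q =>
    (Real.sigmoid (c * inner ℝ θ (pairPoint g (latentPair m T q))) -
      pairLabel (latentPair m T q)) * inner ℝ θ (pairPoint g (latentPair m T q)))
      (latentPairLaw d L) := by
  have hsig := continuous_sigmoid.measurable
  refine ((integrable_sq_inner_pairPoint hg m θ hT).add (integrable_const 1)).mono'
    (by fun_prop) (ae_of_all _ fun q => ?_)
  have h1 := pairLabel_latentPair_mem m T q
  set z : ℝ := inner ℝ θ (pairPoint g (latentPair m T q))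
  have h2 : |Real.sigmoid (c * z) - pairLabel (latentPair m T q)| ≤ 1 := by
    have := Real.sigmoid_nonneg (c * z)
    have := Real.sigmoid_le_one (c * z)
    rw [abs_le]; constructor <;> linarith
  rw [Real.norm_eq_abs, abs_mul]
  refine (mul_le_of_le_one_left (abs_nonneg _) h2).trans ?_
  change |z| ≤ z ^ 2 + 1
  rw [← sq_abs]
  nlinarith [sq_nonneg (|z| - 1), abs_nonneg z]

/-- The sigmoid is 1-Lipschitz, so a change of slope costs at most |c - c'| times the second moment
of ⟨θ, x⟩. -/
theorem abs_radialGradient_sub_le (c c' : ℝ) :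
    |radialGradient g L m θ T c - radialGradient g L m θ T c'| ≤ |c - c'| *
      (4 * ((inner ℝ θ m) ^ 2 + ‖T θ‖ ^ 2) * gaussianExpMoment d 1 ^ 2) := by
  rw [radialGradient, radialGradient, ← integral_sub (integrable_radialGradient hg m θ hT c)
    (integrable_radialGradient hg m θ hT c')]
  refine (abs_integral_le_integral_abs).trans ?_
  refine le_trans ?_ (mul_le_mul_of_nonneg_left (integral_sq_inner_pairPoint_le (L := L) hg m θ hT)
    (abs_nonneg _))
  rw [← integral_const_mul]
  refine integral_mono ((integrable_radialGradient hg m θ hT c).sub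
    (integrable_radialGradient hg m θ hT c')).abs
    ((integrable_sq_inner_pairPoint hg m θ hT).const_mul _) fun q => ?_
  set z : ℝ := inner ℝ θ (pairPoint g (latentPair m T q)) with hz
  have h := abs_sigmoid_sub_le (c * z) (c' * z)
  rw [← sub_mul, abs_mul] at h
  rw [show (Real.sigmoid (c * z) - pairLabel (latentPair m T q)) * z -
    (Real.sigmoid (c' * z) - pairLabel (latentPair m T q)) * z =
    (Real.sigmoid (c * z) - Real.sigmoid (c' * z)) * z by ring, abs_mul, ← sq_abs z]
  nlinarith [abs_nonneg z]

/-- At slope 0 the sigmoid is 1/2 and the gradient is minus half the correlation of signed label and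
mixed point. After the cross terms cancel, the coefficient of ⟨θ, m⟩ averages -1/4 - (2λ - 1)(2g(λ)
- 1)/4, and the product is nonnegative since g(λ) and λ lie on the same side of 1/2. -/
theorem radialGradient_zero_le (hpos : 0 ≤ (inner ℝ θ m : ℝ))
    (hgh : ∀ z : I, 1 / 2 < (g z : ℝ) ↔ 1 / 2 < (z : ℝ)) :
    radialGradient g L m θ T 0 ≤ -(inner ℝ θ m / 4) := by
  let φ : Bool × Bool × I → ℝ := fun x =>
    -(((x.2.2 : ℝ) * boolSign x.1 + (1 - (x.2.2 : ℝ)) * boolSign x.2.1) / 2)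
  have hφ : Measurable φ := by fun_prop
  have hφ1 : ∀ x, |φ x| ≤ 1 := by
    intro x
    have h1 := x.2.2.2.1
    have h2 := x.2.2.2.2
    have h3 := abs_le.1 (abs_boolSign x.1).le
    have h4 := abs_le.1 (abs_boolSign x.2.1).le
    rw [abs_le]
    simp only [φ]
    constructor <;> nlinarith
  have h := (integral_mul_inner_pairPoint (L := L) hg m hT θ hφ hφ1).2
  have e : radialGradient g L m θ T 0 = ∫ q, φ (q.1.1, q.2.1.1, q.2.2) *
      inner ℝ θ (pairPoint g (latentPair m T q)) ∂(latentPairLaw d L) := by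
    rw [radialGradient]
    congr 1
    funext q
    rw [zero_mul, Real.sigmoid_zero, pairLabel_latentPair]
    simp only [φ]
    ring
  rw [e, h]
  have hcross : ∫ q : LatentPair d, ((q.2.2 : ℝ) * (1 - g q.2.2) + (1 - (q.2.2 : ℝ)) * g q.2.2) *
      (boolSign q.1.1 * boolSign q.2.1.1) ∂(latentPairLaw d L) = 0 := by
    refine integral_latentPairLaw_eq_zero (measurePreserving_latent_neg d)
      (MeasurePreserving.id _) (by fun_prop) fun q => ?_
    simp only [boolSign_not, id]
    ring
  have hle : ∫ q : LatentPair d, (φ (q.1.1, q.2.1.1, q.2.2) * mixedSign g q +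
      1 / 2 * (((q.2.2 : ℝ) * (1 - g q.2.2) + (1 - (q.2.2 : ℝ)) * g q.2.2) *
      (boolSign q.1.1 * boolSign q.2.1.1))) ∂(latentPairLaw d L) ≤ -(1 / 4) := by
    have : ∀ q : LatentPair d, (φ (q.1.1, q.2.1.1, q.2.2) * mixedSign g q +
      1 / 2 * (((q.2.2 : ℝ) * (1 - g q.2.2) + (1 - (q.2.2 : ℝ)) * g q.2.2) *
      (boolSign q.1.1 * boolSign q.2.1.1))) =
      -(1 / 4) - (2 * (q.2.2 : ℝ) - 1) * (2 * (g q.2.2 : ℝ) - 1) / 4 := by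
      intro q
      have h1 := boolSign_sq q.1.1
      have h2 := boolSign_sq q.2.1.1
      simp only [φ, mixedSign]
      linear_combination (-(q.2.2 : ℝ) * g q.2.2 / 2) * h1 -
        ((1 - (q.2.2 : ℝ)) * (1 - g q.2.2) / 2) * h2
    have hnn : ∀ z : I, 0 ≤ (2 * (z : ℝ) - 1) * (2 * (g z : ℝ) - 1) := by
      intro z
      by_cases hz : 1 / 2 < (z : ℝ)
      · have := (hgh z).2 hz
        exact mul_nonneg (by linarith) (by linarith)
      · have := mt (hgh z).1 hz
        exact mul_nonneg_of_nonpos_of_nonpos (by linarith) (by linarith)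
    simp_rw [this]
    have hi : Integrable (fun q : LatentPair d =>
        -(1 / 4) - (2 * (q.2.2 : ℝ) - 1) * (2 * (g q.2.2 : ℝ) - 1) / 4) (latentPairLaw d L) := by
      refine integrable_of_bounded_latent (K := 1) (by fun_prop) fun q => ?_
      have h1 := q.2.2.2.1
      have h2 := q.2.2.2.2
      have h3 := (g q.2.2).2.1
      have h4 := (g q.2.2).2.2
      rw [abs_le]
      constructor <;> nlinarith [hnn q.2.2, mul_nonneg h1 h3,
        mul_nonneg (sub_nonneg.2 h2) (sub_nonneg.2 h4), mul_nonneg h1 (sub_nonneg.2 h4),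
        mul_nonneg h3 (sub_nonneg.2 h2)]
    have := integral_mono hi (integrable_const (-(1 / 4) : ℝ)) fun q => by
      have := hnn q.2.2
      linarith
    simpa using this
  rw [integral_add, integral_const_mul, hcross, mul_zero, add_zero] at hle
  · nlinarith
  · refine integrable_of_bounded_latent (K := 1) (by fun_prop) fun q => ?_
    rw [abs_mul]
    exact mul_le_one₀ (hφ1 _) (abs_nonneg _) (abs_mixedSign_le g q)
  · refine (integrable_of_bounded_latent (K := 1) (by fun_prop) fun q => ?_).const_mul _
    have h1 := q.2.2.2.1
    have h2 := q.2.2.2.2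
    have h3 := (g q.2.2).2.1
    have h4 := (g q.2.2).2.2
    rw [abs_mul, abs_mul, abs_boolSign, abs_boolSign, mul_one, mul_one, abs_le]
    constructor <;> nlinarith [mul_nonneg h1 h3, mul_nonneg (sub_nonneg.2 h2) (sub_nonneg.2 h4),
      mul_nonneg h1 (sub_nonneg.2 h4), mul_nonneg h3 (sub_nonneg.2 h2)]

/-- The label of a pair with given classes. -/
noncomputable def signLabel (x : Bool × Bool × I) : ℝ :=
  (1 + ((x.2.2 : ℝ) * boolSign x.1 + (1 - (x.2.2 : ℝ)) * boolSign x.2.1)) / 2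

omit hg hT in
theorem signLabel_mem (x : Bool × Bool × I) : 0 ≤ signLabel x ∧ signLabel x ≤ 1 := by
  have h1 := x.2.2.2.1
  have h2 := x.2.2.2.2
  have h3 := abs_le.1 (abs_boolSign x.1).le
  have h4 := abs_le.1 (abs_boolSign x.2.1).le
  unfold signLabel
  constructor <;> nlinarith

omit hg hT in
@[fun_prop]
theorem measurable_signLabel : Measurable signLabel := by
  unfold signLabel; fun_prop

-- For a pair of opposite classes with λ not 0 or 1 and g(λ) ≠ 1/2, the label is strictly soft and
-- the mean coefficient 2g(λ) - 1 is nonzero; this event has positive probability.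
omit hT in
theorem integral_min_signLabel_mul_pos
    (hL : 0 < L {z : I | z ≠ 0 ∧ z ≠ 1 ∧ (g z : ℝ) ≠ 1 / 2}) :
    0 < ∫ q : LatentPair d, min (signLabel (q.1.1, q.2.1.1, q.2.2))
      (1 - signLabel (q.1.1, q.2.1.1, q.2.2)) * |mixedSign g q| ∂(latentPairLaw d L) := by
  have hnn : ∀ q : LatentPair d, 0 ≤ min (signLabel (q.1.1, q.2.1.1, q.2.2))
      (1 - signLabel (q.1.1, q.2.1.1, q.2.2)) * |mixedSign g q| := fun q => by
    have := signLabel_mem (q.1.1, q.2.1.1, q.2.2)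
    exact mul_nonneg (le_min this.1 (by linarith)) (abs_nonneg _)
  rw [integral_pos_iff_support_of_nonneg hnn]
  · set S := {z : I | z ≠ 0 ∧ z ≠ 1 ∧ (g z : ℝ) ≠ 1 / 2}
    have hcoin : ∀ b, fairCoin {b} ≠ 0 := by
      intro b
      cases b <;> simp [fairCoin]
    have hsub : (({true} : Set Bool) ×ˢ Set.univ) ×ˢ ((({false} : Set Bool) ×ˢ Set.univ) ×ˢ S) ⊆
        Function.support fun q : LatentPair d => min (signLabel (q.1.1, q.2.1.1, q.2.2))
          (1 - signLabel (q.1.1, q.2.1.1, q.2.2)) * |mixedSign g q| := by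
      rintro ⟨⟨b, x⟩, ⟨b', x'⟩, z⟩ ⟨⟨hb, -⟩, ⟨hb', -⟩, hz0, hz1, hz⟩
      simp only [Set.mem_singleton_iff] at hb hb'
      subst hb hb'
      have e : signLabel (true, false, z) = z := by
        simp [signLabel, boolSign]; ring
      have e' : mixedSign (d := d) g ((true, x), (false, x'), z) = 2 * g z - 1 := by
        simp [mixedSign, boolSign]; ring
      have h0 : 0 < (z : ℝ) := lt_of_le_of_ne z.2.1 fun h => hz0 (Subtype.ext h.symm)
      have h1 : (z : ℝ) < 1 := lt_of_le_of_ne z.2.2 fun h => hz1 (Subtype.ext h)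
      simp only [Function.mem_support, e, e']
      refine mul_ne_zero (lt_min h0 (by linarith)).ne' (abs_ne_zero.2 fun h => hz ?_)
      linarith
    refine lt_of_lt_of_le ?_ (measure_mono hsub)
    rw [latentPairLaw, Measure.prod_prod, Measure.prod_prod, latentLaw, Measure.prod_prod,
      Measure.prod_prod]
    simp only [measure_univ, mul_one]
    exact pos_iff_ne_zero.2 (mul_ne_zero (hcoin _) (mul_ne_zero (hcoin _) hL.ne'))
  · refine integrable_of_bounded_latent (K := 1) (by fun_prop) fun q => ?_
    rw [abs_of_nonneg (hnn q)]
    have := signLabel_mem (q.1.1, q.2.1.1, q.2.2)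
    exact mul_le_one₀ ((min_le_left _ _).trans this.2) (abs_nonneg _) (abs_mixedSign_le g q)

/-- For large c the integrand is nearly at least min(y, 1 - y)|z|. Replacing |z| by z times the sign
of the mean coefficient only decreases it and makes it linear in the mixed point, so the noise
averages out. -/
theorem le_radialGradient {c : ℝ} (hc : 0 < c) :
    (∫ q : LatentPair d, min (signLabel (q.1.1, q.2.1.1, q.2.2))
      (1 - signLabel (q.1.1, q.2.1.1, q.2.2)) * |mixedSign g q| ∂(latentPairLaw d L)) *
      inner ℝ θ m - 1 / c ≤ radialGradient g L m θ T c := by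
  let a : Bool × Bool × I → ℝ := fun x =>
    (g x.2.2 : ℝ) * boolSign x.1 + (1 - (g x.2.2 : ℝ)) * boolSign x.2.1
  have ha : Measurable a := by fun_prop
  let φ : Bool × Bool × I → ℝ := fun x =>
    min (signLabel x) (1 - signLabel x) * (if 0 ≤ a x then 1 else -1)
  have hφ : Measurable φ := by
    refine Measurable.mul (by fun_prop) ?_
    exact Measurable.ite (measurableSet_le measurable_const ha) measurable_const measurable_const
  have hsgn : ∀ x, |(if 0 ≤ a x then (1 : ℝ) else -1)| = 1 := fun x => by
    split_ifs <;> simp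
  have hmin : ∀ x, 0 ≤ min (signLabel x) (1 - signLabel x) := fun x => by
    have := signLabel_mem x
    exact le_min this.1 (by linarith)
  have hφ1 : ∀ x, |φ x| ≤ 1 := fun x => by
    rw [abs_mul, hsgn, mul_one, abs_of_nonneg (hmin x)]
    exact (min_le_left _ _).trans (signLabel_mem x).2
  obtain ⟨hi, h⟩ := integral_mul_inner_pairPoint (L := L) hg m hT θ hφ hφ1
  have e : ∀ q : LatentPair d, φ (q.1.1, q.2.1.1, q.2.2) * mixedSign g q =
      min (signLabel (q.1.1, q.2.1.1, q.2.2))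
      (1 - signLabel (q.1.1, q.2.1.1, q.2.2)) * |mixedSign g q| := by
    intro q
    change _ * (if 0 ≤ mixedSign g q then (1 : ℝ) else -1) * mixedSign g q = _
    split_ifs with h0
    · rw [abs_of_nonneg h0]; ring
    · rw [abs_of_neg (not_le.1 h0)]; ring
  simp_rw [e] at h
  rw [← h]
  have hmono := integral_mono (hi.sub (integrable_const (1 / c)))
    (integrable_radialGradient (L := L) hg m θ hT c) fun q => by
      have h2 := min_mul_abs_sub_le (z := inner ℝ θ (pairPoint g (latentPair m T q)))
        (y := pairLabel (latentPair m T q)) hc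
      refine le_trans ?_ h2
      simp only [Pi.sub_apply]
      refine sub_le_sub_right ?_ _
      have h3 : pairLabel (latentPair m T q) = signLabel (q.1.1, q.2.1.1, q.2.2) := by
        rw [pairLabel_latentPair]; rfl
      rw [h3]
      simp only [φ]
      rw [mul_assoc]
      refine mul_le_mul_of_nonneg_left ?_ (hmin _)
      refine (le_abs_self _).trans ?_
      rw [abs_mul, hsgn, one_mul]
  rw [integral_sub' hi (integrable_const _)] at hmono
  simpa [radialGradient] using hmono

omit hT in
/-- The radial population gradient vanishes at a slope bounded away from `0` and `∞`, uniformly in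
the noise. -/
theorem exists_radialGradient_eq_zero (hpos : 0 < (inner ℝ θ m : ℝ))
    (hgh : ∀ z : I, 1 / 2 < (g z : ℝ) ↔ 1 / 2 < (z : ℝ))
    (hL : 0 < L {z : I | z ≠ 0 ∧ z ≠ 1 ∧ (g z : ℝ) ≠ 1 / 2}) (τ : ℝ) :
    ∃ lo hi : ℝ, 0 < lo ∧ lo ≤ hi ∧
      ∀ T : EuclideanSpace ℝ (Fin d) →L[ℝ] EuclideanSpace ℝ (Fin d),
      (∀ x y, inner ℝ x (T y) = inner ℝ (T x) y) → (∀ x, ‖T x‖ ≤ τ * ‖x‖) →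
      ∃ c, lo ≤ c ∧ c ≤ hi ∧ radialGradient g L m θ T c = 0 := by
  set p : ℝ := inner ℝ θ m with hp
  set Q := 4 * (p ^ 2 + (τ * ‖θ‖) ^ 2) * gaussianExpMoment d 1 ^ 2 with hQ
  have hQ0 : 0 < Q := by
    have := gaussianExpMoment_pos d 1
    positivity
  set A := ∫ q : LatentPair d, min (signLabel (q.1.1, q.2.1.1, q.2.2))
      (1 - signLabel (q.1.1, q.2.1.1, q.2.2)) * |mixedSign g q| ∂(latentPairLaw d L) with hA
  have hA0 : 0 < A := integral_min_signLabel_mul_pos hg hL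
  -- Starting at or below -p/4 with Lipschitz constant Q, the radial gradient is still nonpositive
  -- at p/(4Q); and A p - 1/c ≥ 0 once c ≥ 1/(A p). Neither endpoint involves T beyond its norm
  -- bound τ.
  refine ⟨p / (4 * Q), max (p / (4 * Q)) (1 / (A * p)), by positivity, le_max_left _ _,
    fun T hT hTτ => ?_⟩
  have hQT : 4 * (p ^ 2 + ‖T θ‖ ^ 2) * gaussianExpMoment d 1 ^ 2 ≤ Q := by
    have := hTτ θ
    rw [hQ]
    gcongr
  have hlip : ∀ c c', |radialGradient g L m θ T c - radialGradient g L m θ T c'| ≤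
      |c - c'| * Q := fun c c' =>
    (abs_radialGradient_sub_le hg m θ hT c c').trans
      (mul_le_mul_of_nonneg_left hQT (abs_nonneg _))
  have hcont : Continuous (radialGradient g L m θ T) := by
    refine (LipschitzWith.of_dist_le_mul (K := Q.toNNReal) fun c c' => ?_).continuous
    rw [Real.dist_eq, Real.dist_eq, Real.coe_toNNReal _ hQ0.le, mul_comm]
    exact hlip c c'
  set lo := p / (4 * Q) with hlo
  have hlo0 : 0 < lo := by positivity
  set hi := max lo (1 / (A * p)) with hhi
  have h1 : radialGradient g L m θ T lo ≤ 0 := by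
    have h0 := radialGradient_zero_le (L := L) hg m θ hT hpos.le hgh
    have := (abs_le.1 (hlip lo 0)).2
    rw [sub_zero, abs_of_pos hlo0] at this
    have e : lo * Q = p / 4 := by rw [hlo]; field_simp
    linarith
  have h2 : 0 ≤ radialGradient g L m θ T hi := by
    have hhi0 : 0 < hi := hlo0.trans_le (le_max_left _ _)
    refine le_trans ?_ (le_radialGradient (L := L) hg m θ hT hhi0)
    rw [sub_nonneg, div_le_iff₀ hhi0]
    have : 1 / (A * p) ≤ hi := le_max_right _ _
    rw [div_le_iff₀ (by positivity)] at this
    linarith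
  obtain ⟨c, hc, hc'⟩ := intermediate_value_Icc (le_max_left lo (1 / (A * p)))
    hcont.continuousOn ⟨h1, h2⟩
  exact ⟨c, hc.1, hc.2, hc'⟩

end

/-! ### The noise operator and the vanishing population gradient -/

section

variable {d : ℕ}

open scoped MatrixOrder in
/-- The square root of the covariance `κ⁻¹ C`, as an operator. -/
noncomputable def noiseMap (C : Matrix (Fin d) (Fin d) ℝ) (κ : ℝ) :
    EuclideanSpace ℝ (Fin d) →L[ℝ] EuclideanSpace ℝ (Fin d) :=
  Matrix.toEuclideanCLM (𝕜 := ℝ) (CFC.sqrt (κ⁻¹ • C))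

open scoped MatrixOrder in
theorem inner_noiseMap (C : Matrix (Fin d) (Fin d) ℝ) (κ : ℝ) (x y : EuclideanSpace ℝ (Fin d)) :
    inner ℝ x (noiseMap C κ y) = (inner ℝ (noiseMap C κ x) y : ℝ) := by
  have h : IsSelfAdjoint (noiseMap C κ) := (CFC.sqrt_nonneg (κ⁻¹ • C)).isSelfAdjoint.map _
  rw [← ContinuousLinearMap.adjoint_inner_left, h.adjoint_eq]

open scoped MatrixOrder in
theorem noiseMap_noiseMap {C : Matrix (Fin d) (Fin d) ℝ} (hC : C.PosDef) {κ : ℝ} (hκ : 0 < κ)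
    (x : EuclideanSpace ℝ (Fin d)) :
    noiseMap C κ (noiseMap C κ x) = κ⁻¹ • Matrix.toEuclideanCLM (𝕜 := ℝ) C x := by
  have h : (κ⁻¹ • C).PosSemidef := hC.posSemidef.smul (inv_nonneg.2 hκ.le)
  rw [noiseMap, ← ContinuousLinearMap.comp_apply, ← ContinuousLinearMap.mul_def, ← map_mul,
    CFC.sqrt_mul_sqrt_self _ h.nonneg, map_smul]
  rfl

theorem inner_noiseMap_noiseMap {C : Matrix (Fin d) (Fin d) ℝ} (hC : C.PosDef) {κ : ℝ}
    (hκ : 0 < κ) (x y : EuclideanSpace ℝ (Fin d)) :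
    inner ℝ (noiseMap C κ x) (noiseMap C κ y) =
      κ⁻¹ * (inner ℝ x (Matrix.toEuclideanCLM (𝕜 := ℝ) C y) : ℝ) := by
  rw [← inner_noiseMap, noiseMap_noiseMap hC hκ, inner_smul_right]

theorem norm_sq_noiseMap {C : Matrix (Fin d) (Fin d) ℝ} (hC : C.PosDef) {κ : ℝ}
    (hκ : 0 < κ) (x : EuclideanSpace ℝ (Fin d)) :
    ‖noiseMap C κ x‖ ^ 2 = κ⁻¹ * ‖noiseMap C 1 x‖ ^ 2 := by
  rw [← real_inner_self_eq_norm_sq, ← real_inner_self_eq_norm_sq, inner_noiseMap_noiseMap hC hκ,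
    inner_noiseMap_noiseMap hC one_pos]
  simp

/-- For κ ≥ 1 the covariance is dominated by the one at κ = 1, so the bounds that depend on T only
through its norm are uniform in κ. -/
theorem norm_noiseMap_le {C : Matrix (Fin d) (Fin d) ℝ} (hC : C.PosDef) {κ : ℝ}
    (hκ : 1 ≤ κ) (x : EuclideanSpace ℝ (Fin d)) :
    ‖noiseMap C κ x‖ ≤ ‖noiseMap C 1‖ * ‖x‖ := by
  refine le_trans ?_ ((noiseMap C 1).le_opNorm x)
  refine le_of_sq_le_sq ?_ (norm_nonneg _)
  rw [norm_sq_noiseMap hC (by linarith)]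
  exact mul_le_of_le_one_left (sq_nonneg _) (inv_le_one_of_one_le₀ hκ)

theorem toEuclideanCLM_mul_inv {C : Matrix (Fin d) (Fin d) ℝ} (hC : C.PosDef)
    (x : EuclideanSpace ℝ (Fin d)) :
    Matrix.toEuclideanCLM (𝕜 := ℝ) C (Matrix.toEuclideanCLM (𝕜 := ℝ) C⁻¹ x) = x := by
  have h : C * C⁻¹ = 1 := Matrix.mul_nonsing_inv _ ((Matrix.isUnit_iff_isUnit_det _).1 hC.isUnit)
  rw [← ContinuousLinearMap.comp_apply, ← ContinuousLinearMap.mul_def, ← map_mul, h, map_one]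
  rfl

/-- The noise is nondegenerate in all directions. -/
theorem exists_le_norm_sq_noiseMap {C : Matrix (Fin d) (Fin d) ℝ} (hC : C.PosDef) :
    ∃ s : ℝ, 0 < s ∧ ∀ κ : ℝ, 0 < κ → ∀ x, s / κ * ‖x‖ ^ 2 ≤ ‖noiseMap C κ x‖ ^ 2 := by
  have hker : LinearMap.ker (noiseMap C 1).toLinearMap = ⊥ := by
    rw [LinearMap.ker_eq_bot']
    intro x hx
    have h0 : noiseMap C 1 x = 0 := hx
    have h1 := noiseMap_noiseMap hC one_pos x
    rw [h0, map_zero, inv_one, one_smul] at h1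
    have h : C⁻¹ * C = 1 := Matrix.nonsing_inv_mul _ ((Matrix.isUnit_iff_isUnit_det _).1 hC.isUnit)
    have h2 : Matrix.toEuclideanCLM (𝕜 := ℝ) C⁻¹ (Matrix.toEuclideanCLM (𝕜 := ℝ) C x) = x := by
      rw [← ContinuousLinearMap.comp_apply, ← ContinuousLinearMap.mul_def, ← map_mul, h, map_one]
      rfl
    rw [← h2, ← h1, map_zero]
  obtain ⟨K, hK, hanti⟩ := LinearMap.exists_antilipschitzWith (noiseMap C 1).toLinearMap hker
  have hK' : (0 : ℝ) < K := hK
  refine ⟨((K : ℝ) ^ 2)⁻¹, by positivity, fun κ hκ x => ?_⟩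
  rw [norm_sq_noiseMap hC hκ]
  have h1 : ‖x‖ ≤ K * ‖noiseMap C 1 x‖ := by
    have := hanti.le_mul_dist x 0
    simpa using this
  have h2 : ‖x‖ ^ 2 ≤ (K : ℝ) ^ 2 * ‖noiseMap C 1 x‖ ^ 2 := by
    rw [← mul_pow]; gcongr
  have h3 : ((K : ℝ) ^ 2)⁻¹ * ‖x‖ ^ 2 ≤ ‖noiseMap C 1 x‖ ^ 2 := by
    rwa [inv_mul_le_iff₀ (by positivity)]
  calc _ = κ⁻¹ * (((K : ℝ) ^ 2)⁻¹ * ‖x‖ ^ 2) := by ring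
    _ ≤ _ := mul_le_mul_of_nonneg_left h3 (inv_nonneg.2 hκ.le)

/-- The law of a pair of data points and a mixing coefficient. -/
noncomputable def pairLaw (m : EuclideanSpace ℝ (Fin d)) (C : Matrix (Fin d) (Fin d) ℝ) (κ : ℝ)
    (L : Measure I) :
    Measure ((EuclideanSpace ℝ (Fin d) × ℝ) × (EuclideanSpace ℝ (Fin d) × ℝ) × I) :=
  (dataLaw m C κ).prod ((dataLaw m C κ).prod L)

theorem measurePreserving_latentPair (m : EuclideanSpace ℝ (Fin d))
    (C : Matrix (Fin d) (Fin d) ℝ) (κ : ℝ) (L : Measure I) [IsProbabilityMeasure L] :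
    MeasurePreserving (latentPair m (noiseMap C κ)) (latentPairLaw d L) (pairLaw m C κ L) :=
  ⟨by fun_prop, (dataLaw_pair_eq_map m C κ L).symm⟩

theorem integral_pairLaw (m : EuclideanSpace ℝ (Fin d))
    (C : Matrix (Fin d) (Fin d) ℝ) (κ : ℝ) (L : Measure I) [IsProbabilityMeasure L]
    {h : (EuclideanSpace ℝ (Fin d) × ℝ) × (EuclideanSpace ℝ (Fin d) × ℝ) × I → ℝ}
    (hh : Measurable h) :
    ∫ q, h q ∂(pairLaw m C κ L) = ∫ q, h (latentPair m (noiseMap C κ) q) ∂(latentPairLaw d L) := by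
  have hmp := measurePreserving_latentPair m C κ L
  rw [← hmp.map_eq, integral_map hmp.measurable.aemeasurable hh.aestronglyMeasurable]

/-- At a multiple of `C⁻¹ m` where the radial component of the population gradient vanishes, the
whole population gradient vanishes. -/
theorem integral_gradient_eq_zero {L : Measure I} [IsProbabilityMeasure L] {g : I → I}
    (hg : Measurable g) {m : EuclideanSpace ℝ (Fin d)} {C : Matrix (Fin d) (Fin d) ℝ}
    (hC : C.PosDef) {κ : ℝ} (hκ : 0 < κ) {θ : EuclideanSpace ℝ (Fin d)}
    (hθ : Matrix.toEuclideanCLM (𝕜 := ℝ) C θ = m) (hpos : 0 < (inner ℝ θ m : ℝ)) {c : ℝ}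
    (hc : radialGradient g L m θ (noiseMap C κ) c = 0) (v : EuclideanSpace ℝ (Fin d)) :
    ∫ q, (Real.sigmoid (inner ℝ (c • θ) (pairPoint g q)) - pairLabel q) *
      inner ℝ v (pairPoint g q) ∂(pairLaw m C κ L) = 0 := by
  have hsig := continuous_sigmoid.measurable
  rw [integral_pairLaw m C κ L (by fun_prop)]
  set T := noiseMap C κ with hT
  have hTs := inner_noiseMap C κ
  -- Write v = u + αθ with u ⟂ m. Since Cθ = m, being orthogonal to m is the same as being conjugate
  -- to θ, so u falls under the reflection argument and θ under the choice of c.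
  set α : ℝ := inner ℝ v m / inner ℝ θ m with hα
  set u := v - α • θ with hu
  have hum : inner ℝ u m = (0 : ℝ) := by
    rw [hu, inner_sub_left, inner_smul_left, hα]
    simp only [conj_trivial]
    field_simp
    simp
  have h1 := integral_sigmoid_sub_mul_inner_eq_zero (L := L) hg m θ hTs u hum (by
    rw [inner_noiseMap_noiseMap hC hκ, hθ, hum, mul_zero]) c
  have hsplit : ∀ q : LatentPair d,
      (Real.sigmoid (inner ℝ (c • θ) (pairPoint g (latentPair m T q))) -
        pairLabel (latentPair m T q)) * inner ℝ v (pairPoint g (latentPair m T q)) =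
      (Real.sigmoid (c * inner ℝ θ (pairPoint g (latentPair m T q))) -
        pairLabel (latentPair m T q)) * inner ℝ u (pairPoint g (latentPair m T q)) +
      α * ((Real.sigmoid (c * inner ℝ θ (pairPoint g (latentPair m T q))) -
        pairLabel (latentPair m T q)) * inner ℝ θ (pairPoint g (latentPair m T q))) := fun q => by
    rw [inner_smul_left, hu, inner_sub_left, inner_smul_left]
    simp only [conj_trivial]
    ring
  simp_rw [hsplit]
  have i1 := integrable_radialGradient (L := L) hg m θ hTs c
  have i2 : Integrable (fun q : LatentPair d =>
      (Real.sigmoid (c * inner ℝ θ (pairPoint g (latentPair m T q))) -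
        pairLabel (latentPair m T q)) * inner ℝ u (pairPoint g (latentPair m T q)))
      (latentPairLaw d L) := by
    refine ((integrable_sq_inner_pairPoint (L := L) hg m u hTs).add (integrable_const 1)).mono'
      (by fun_prop) (ae_of_all _ fun q => ?_)
    have h1 := pairLabel_latentPair_mem m T q
    set z : ℝ := inner ℝ u (pairPoint g (latentPair m T q))
    set y := c * (inner ℝ θ (pairPoint g (latentPair m T q)) : ℝ)
    have h2 : |Real.sigmoid y - pairLabel (latentPair m T q)| ≤ 1 := by
      have := Real.sigmoid_nonneg y
      have := Real.sigmoid_le_one y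
      rw [abs_le]; constructor <;> linarith
    rw [Real.norm_eq_abs, abs_mul]
    refine (mul_le_of_le_one_left (abs_nonneg _) h2).trans ?_
    change |z| ≤ z ^ 2 + 1
    rw [← sq_abs]
    nlinarith [sq_nonneg (|z| - 1), abs_nonneg z]
  rw [integral_add i2 (i1.const_mul α), h1, integral_const_mul, zero_add]
  change α * radialGradient g L m θ T c = 0
  rw [hc, mul_zero]

/-! ### Concentration of pair statistics, uniformly in κ -/

/-- The off-diagonal sum of the centered values of a pair statistic. -/
noncomputable def centeredSum {n : ℕ} (m : EuclideanSpace ℝ (Fin d))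
    (C : Matrix (Fin d) (Fin d) ℝ) (κ : ℝ) (L : Measure I)
    (h : (EuclideanSpace ℝ (Fin d) × ℝ) × (EuclideanSpace ℝ (Fin d) × ℝ) × I → ℝ)
    (ω : MixupSample d n) : ℝ :=
  ∑ i, ∑ j, if i = j then 0 else
    h (ω.1 i, ω.1 j, ω.2 (i, j)) - ∫ q, h q ∂(pairLaw m C κ L)

theorem measurable_centeredSum {n : ℕ} (m : EuclideanSpace ℝ (Fin d))
    (C : Matrix (Fin d) (Fin d) ℝ) (κ : ℝ) (L : Measure I)
    {h : (EuclideanSpace ℝ (Fin d) × ℝ) × (EuclideanSpace ℝ (Fin d) × ℝ) × I → ℝ}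
    (hh : Measurable h) : Measurable (centeredSum (n := n) m C κ L h) := by
  refine Finset.measurable_sum _ fun i _ => Finset.measurable_sum _ fun j _ => ?_
  split_ifs
  · exact measurable_const
  · exact (hh.comp (by fun_prop)).sub_const _

/-- Concentration of pair statistics of at most linear growth, uniformly in the noise level. -/
theorem exists_measure_abs_centeredSum_ge_le (m : EuclideanSpace ℝ (Fin d))
    {C : Matrix (Fin d) (Fin d) ℝ} (hC : C.PosDef) (L : Measure I) [IsProbabilityMeasure L] :
    ∃ B V : ℝ, 0 < B ∧ 1 ≤ V ∧ ∀ κ : ℝ, 1 ≤ κ →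
      ∀ h : (EuclideanSpace ℝ (Fin d) × ℝ) × (EuclideanSpace ℝ (Fin d) × ℝ) × I → ℝ,
      Measurable h → (∀ q, |h (latentPair m (noiseMap C κ) q)| ≤
        2 + (‖(latentPair m (noiseMap C κ) q).1.1‖ + ‖(latentPair m (noiseMap C κ) q).2.1.1‖)) →
      |∫ q, h q ∂(pairLaw m C κ L)| ≤ B ∧
      Integrable h (pairLaw m C κ L) ∧
      ∀ (n : ℕ) [NeZero n] (η : ℝ), 0 < η → η ≤ 1 →
        mixupLaw m C κ L n {ω | η * (n : ℝ) ^ 2 ≤ |centeredSum m C κ L h ω|} ≤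
          ENNReal.ofReal (2 * Real.exp (-(n * η ^ 2 / (16 * V)))) := by
  set τ := ‖noiseMap C 1‖
  set B := 2 + Real.exp (2 * 1 * ‖m‖) * gaussianExpMoment d (1 * τ) ^ 2 with hB
  -- A centered statistic is dominated by (2 + B) plus the two norms; M bounds the exponential
  -- moment of twice that. The added 1 only ensures V ≥ 1, so that η ≤ 1 implies η ≤ 4V.
  set M := Real.exp (2 * (2 + B)) * (Real.exp (2 * 2 * ‖m‖) * gaussianExpMoment d (2 * τ) ^ 2) + 1
    with hM
  have hM1 : 1 ≤ M := by rw [hM]; linarith [show 0 ≤ Real.exp (2 * (2 + B)) *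
    (Real.exp (2 * 2 * ‖m‖) * gaussianExpMoment d (2 * τ) ^ 2) by positivity]
  refine ⟨B, 2 * M, by positivity, by linarith, fun κ hκ h hh hbound => ?_⟩
  set T := noiseMap C κ with hT
  have hTτ : ∀ x, ‖T x‖ ≤ τ * ‖x‖ := norm_noiseMap_le hC hκ
  let r : LatentPair d → ℝ := fun q => ‖(latentPair m T q).1.1‖ + ‖(latentPair m T q).2.1.1‖
  have hr : Measurable r := by fun_prop
  have iexp : ∀ t, 0 ≤ t → Integrable (fun q => Real.exp (t * r q)) (latentPairLaw d L) ∧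
      ∫ q, Real.exp (t * r q) ∂(latentPairLaw d L) ≤
        Real.exp (2 * t * ‖m‖) * gaussianExpMoment d (t * τ) ^ 2 := by
    intro t ht
    have hi : Integrable (fun q => Real.exp (t * r q)) (latentPairLaw d L) := by
      refine integrable_of_le_noiseExp (by fun_prop) (Real.exp (2 * t * ‖m‖)) (t * τ) fun q => ?_
      rw [abs_of_pos (Real.exp_pos _)]
      exact exp_norm_latentPair_le hTτ ht q
    refine ⟨hi, ?_⟩
    rw [← integral_noiseExp d L, ← integral_const_mul]
    exact integral_mono hi ((integrable_noiseExp d L _).const_mul _)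
      fun q => exp_norm_latentPair_le hTτ ht q
  have hhl : Measurable fun q => h (latentPair m T q) := hh.comp (by fun_prop)
  have hle : ∀ q, |h (latentPair m T q)| ≤ 2 + Real.exp (1 * r q) := fun q => by
    have := Real.add_one_le_exp (1 * r q)
    have := hbound q
    simp only [r] at *
    linarith
  have iexp1 := iexp 1 zero_le_one
  have ih : Integrable (fun q => h (latentPair m T q)) (latentPairLaw d L) :=
    ((integrable_const 2).add iexp1.1).mono' hhl.aestronglyMeasurable (ae_of_all _ hle)
  have hmp := measurePreserving_latentPair m C κ L
  have hmean := integral_pairLaw m C κ L hh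
  have hmeanB : |∫ q, h q ∂(pairLaw m C κ L)| ≤ B := by
    rw [hmean]
    refine abs_integral_le_integral_abs.trans ?_
    refine (integral_mono ih.abs ((integrable_const 2).add iexp1.1) hle).trans ?_
    rw [integral_add' (integrable_const _) iexp1.1]
    simp only [integral_const, probReal_univ, smul_eq_mul, one_mul]
    rw [hB]
    simpa using iexp1.2
  refine ⟨hmeanB, ?_, ?_⟩
  · rw [← hmp.map_eq, integrable_map_measure hh.aestronglyMeasurable hmp.measurable.aemeasurable]
    exact ih
  intro n _ η hη hη1
  have hmgf : ∀ s : ℝ, |s| = 1 → ∀ a : ℝ, |a| ≤ 1 →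
      ∫⁻ y, ENNReal.ofReal (Real.exp (a * (s * (h y - ∫ q, h q ∂(pairLaw m C κ L)))))
        ∂(pairLaw m C κ L) ≤ ENNReal.ofReal (Real.exp (a ^ 2 * (2 * M))) := by
    intro s hs a ha
    have hmeas : Measurable fun y => ENNReal.ofReal
      (Real.exp (a * (s * (h y - ∫ q, h q ∂(pairLaw m C κ L))))) := by fun_prop
    have hY : ∀ q, Real.exp (2 * ((2 + B) + r q)) =
        Real.exp (2 * (2 + B)) * Real.exp (2 * r q) := fun q => by
      rw [mul_add, Real.exp_add]
    rw [← hmp.lintegral_comp hmeas]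
    refine lintegral_exp_mul_le_of_centered (P := latentPairLaw d L)
      (X := fun q => s * (h (latentPair m T q) - ∫ q, h q ∂(pairLaw m C κ L)))
      (by fun_prop) ?_ (Y := fun q => (2 + B) + r q) ?_ ?_ ?_ ha
    · rw [integral_const_mul, integral_sub ih (integrable_const _), hmean]
      simp [hT]
    · intro q
      rw [abs_mul, hs, one_mul]
      refine (abs_sub _ _).trans ?_
      have := hbound q
      simp only [r] at *
      linarith
    · simp only [hY]
      exact (iexp 2 zero_le_two).1.const_mul _
    · simp only [hY]
      rw [integral_const_mul]
      have := mul_le_mul_of_nonneg_left (iexp 2 zero_le_two).2 (Real.exp_pos (2 * (2 + B))).le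
      rw [hM]
      linarith
  have htail : ∀ s : ℝ, |s| = 1 →
      mixupLaw m C κ L n {ω | η * (n : ℝ) ^ 2 ≤ s * centeredSum m C κ L h ω} ≤
        ENNReal.ofReal (Real.exp (-(n * η ^ 2 / (16 * (2 * M))))) := by
    intro s hs
    have := measure_offDiag_ge_le (n := n) (dataLaw m C κ) L
      (f := fun y => s * (h y - ∫ q, h q ∂(pairLaw m C κ L))) (by fun_prop) (V := 2 * M)
      (by linarith) hη (by linarith) (hmgf s hs)
    refine le_trans (le_of_eq ?_) this
    congr 1
    ext ω
    simp only [centeredSum, Finset.mul_sum, mul_ite, mul_zero]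
  have hsub : {ω : MixupSample d n | η * (n : ℝ) ^ 2 ≤ |centeredSum m C κ L h ω|} ⊆
      {ω | η * (n : ℝ) ^ 2 ≤ 1 * centeredSum m C κ L h ω} ∪
      {ω | η * (n : ℝ) ^ 2 ≤ -1 * centeredSum m C κ L h ω} := by
    intro ω hω
    rcases le_abs.1 (show η * (n : ℝ) ^ 2 ≤ |centeredSum m C κ L h ω| from hω) with h1 | h1
    · left; simpa using h1
    · right; simpa using h1
  refine (measure_mono hsub).trans ((measure_union_le _ _).trans ?_)
  refine (add_le_add (htail 1 (by simp)) (htail (-1) (by simp))).trans ?_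
  rw [← ENNReal.ofReal_add (Real.exp_pos _).le (Real.exp_pos _).le,
    two_mul (Real.exp _)]

end

/-! ### Gradient and curvature of the empirical loss -/

section

variable {d : ℕ}

/-- The gradient of the Mixup loss. -/
noncomputable def mixupGradient {n : ℕ} (g : I → I) (ω : MixupSample d n)
    (w : EuclideanSpace ℝ (Fin d)) : EuclideanSpace ℝ (Fin d) :=
  (1 / (n : ℝ) ^ 2) • ∑ i, ∑ j,
    (Real.sigmoid (inner ℝ w (mixedPoint g ω i j)) - mixedLabel ω i j) • mixedPoint g ω i j

theorem inner_mixupGradient {n : ℕ} (g : I → I) (ω : MixupSample d n)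
    (w u : EuclideanSpace ℝ (Fin d)) :
    inner ℝ (mixupGradient g ω w) u = 1 / (n : ℝ) ^ 2 * ∑ i, ∑ j,
      (Real.sigmoid (inner ℝ w (mixedPoint g ω i j)) - mixedLabel ω i j) *
        inner ℝ u (mixedPoint g ω i j) := by
  rw [mixupGradient, inner_smul_left, sum_inner]
  simp only [sum_inner, inner_smul_left, conj_trivial, real_inner_comm]

theorem continuous_mixupLoss {n : ℕ} (g : I → I) (ω : MixupSample d n) :
    Continuous (mixupLoss g ω) := by
  have h : Continuous softplus :=
    continuous_iff_continuousAt.2 fun z => (hasDerivAt_softplus z).continuousAt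
  unfold mixupLoss
  simp only [pointLoss_eq]
  fun_prop

theorem mixupLoss_add_le {n : ℕ} (g : I → I) (ω : MixupSample d n)
    (w v : EuclideanSpace ℝ (Fin d)) (r : Fin n → Fin n → ℝ)
    (hr : ∀ i j, softplus (inner ℝ w (mixedPoint g ω i j)) +
      Real.sigmoid (inner ℝ w (mixedPoint g ω i j)) *
      (inner ℝ v (mixedPoint g ω i j) - inner ℝ w (mixedPoint g ω i j)) + r i j ≤
      softplus (inner ℝ v (mixedPoint g ω i j))) :
    mixupLoss g ω w + inner ℝ (mixupGradient g ω w) (v - w) +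
      1 / (n : ℝ) ^ 2 * ∑ i, ∑ j, r i j ≤ mixupLoss g ω v := by
  rw [inner_mixupGradient, mixupLoss, mixupLoss, ← mul_add, ← mul_add, ← Finset.sum_add_distrib,
    ← Finset.sum_add_distrib]
  refine mul_le_mul_of_nonneg_left (Finset.sum_le_sum fun i _ => ?_) (by positivity)
  rw [← Finset.sum_add_distrib, ← Finset.sum_add_distrib]
  refine Finset.sum_le_sum fun j _ => ?_
  rw [pointLoss_eq, pointLoss_eq, inner_sub_left]
  linarith [hr i j]

theorem mixupLoss_tangent_le {n : ℕ} (g : I → I) (ω : MixupSample d n)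
    (w v : EuclideanSpace ℝ (Fin d)) :
    mixupLoss g ω w + inner ℝ (mixupGradient g ω w) (v - w) ≤ mixupLoss g ω v := by
  have := mixupLoss_add_le g ω w v (fun _ _ => 0) fun i j => by
    rw [add_zero]; exact softplus_tangent_le _ _
  simpa using this

/-- On the ball every margin |⟨w, x⟩| is at most W‖x‖, so one weight serves all pairs w, v, and the
curvature becomes a quadratic form that depends only on the sample. -/
theorem mixupLoss_strong_tangent_le {n : ℕ} (g : I → I) (ω : MixupSample d n) {W : ℝ}
    {w v : EuclideanSpace ℝ (Fin d)} (hw : ‖w‖ ≤ W) (hv : ‖v‖ ≤ W) :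
    mixupLoss g ω w + inner ℝ (mixupGradient g ω w) (v - w) +
      1 / 8 * (1 / (n : ℝ) ^ 2 * ∑ i, ∑ j, Real.exp (-(W * ‖mixedPoint g ω i j‖)) *
        (inner ℝ (v - w) (mixedPoint g ω i j)) ^ 2) ≤ mixupLoss g ω v := by
  have := mixupLoss_add_le g ω w v (fun i j => Real.exp (-(W * ‖mixedPoint g ω i j‖)) / 8 *
        (inner ℝ v (mixedPoint g ω i j) - inner ℝ w (mixedPoint g ω i j)) ^ 2) fun i j => by
    refine softplus_strong_tangent_le ?_ ?_
    · exact (abs_real_inner_le_norm _ _).trans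
        (mul_le_mul_of_nonneg_right hw (norm_nonneg _))
    · exact (abs_real_inner_le_norm _ _).trans
        (mul_le_mul_of_nonneg_right hv (norm_nonneg _))
  refine le_trans (le_of_eq ?_) this
  congr 1
  simp only [Finset.mul_sum, inner_sub_left]
  refine Finset.sum_congr rfl fun i _ => Finset.sum_congr rfl fun j _ => ?_
  ring

/-- A coordinate of the gradient of the loss at a mixed point. -/
noncomputable def gradientStat (g : I → I) (w v : EuclideanSpace ℝ (Fin d))
    (q : (EuclideanSpace ℝ (Fin d) × ℝ) × (EuclideanSpace ℝ (Fin d) × ℝ) × I) : ℝ :=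
  (Real.sigmoid (inner ℝ w (pairPoint g q)) - pairLabel q) * inner ℝ v (pairPoint g q)

/-- An entry of the weighted second moment matrix at a mixed point. -/
noncomputable def momentStat (g : I → I) (W : ℝ) (u v : EuclideanSpace ℝ (Fin d))
    (q : (EuclideanSpace ℝ (Fin d) × ℝ) × (EuclideanSpace ℝ (Fin d) × ℝ) × I) : ℝ :=
  Real.exp (-(W * ‖pairPoint g q‖)) * (inner ℝ u (pairPoint g q) * inner ℝ v (pairPoint g q))

/-- A statistic that controls the unmixed points. -/
noncomputable def sizeStat
    (q : (EuclideanSpace ℝ (Fin d) × ℝ) × (EuclideanSpace ℝ (Fin d) × ℝ) × I) : ℝ :=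
  ‖q.1.1‖ * (1 + |q.1.2|) / 2

theorem measurable_gradientStat {g : I → I} (hg : Measurable g) (w v : EuclideanSpace ℝ (Fin d)) :
    Measurable (gradientStat g w v) := by
  have := continuous_sigmoid.measurable
  unfold gradientStat
  fun_prop

theorem measurable_momentStat {g : I → I} (hg : Measurable g) (W : ℝ)
    (u v : EuclideanSpace ℝ (Fin d)) : Measurable (momentStat g W u v) := by
  unfold momentStat
  fun_prop

theorem measurable_sizeStat : Measurable (sizeStat (d := d)) := by
  unfold sizeStat
  have : Measurable fun y : ℝ => |y| := continuous_abs.measurable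
  fun_prop

theorem abs_gradientStat_le (g : I → I) (m : EuclideanSpace ℝ (Fin d))
    (T : EuclideanSpace ℝ (Fin d) →L[ℝ] EuclideanSpace ℝ (Fin d))
    (w : EuclideanSpace ℝ (Fin d)) {v : EuclideanSpace ℝ (Fin d)} (hv : ‖v‖ = 1)
    (q : LatentPair d) : |gradientStat g w v (latentPair m T q)| ≤
      2 + (‖(latentPair m T q).1.1‖ + ‖(latentPair m T q).2.1.1‖) := by
  have h1 := pairLabel_latentPair_mem m T q
  have h2 : |Real.sigmoid (inner ℝ w (pairPoint g (latentPair m T q))) -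
      pairLabel (latentPair m T q)| ≤ 1 := by
    have := Real.sigmoid_nonneg (inner ℝ w (pairPoint g (latentPair m T q)))
    have := Real.sigmoid_le_one (inner ℝ w (pairPoint g (latentPair m T q)))
    rw [abs_le]; constructor <;> linarith
  rw [gradientStat, abs_mul]
  refine (mul_le_of_le_one_left (abs_nonneg _) h2).trans ?_
  refine (abs_real_inner_le_norm _ _).trans ?_
  rw [hv, one_mul]
  linarith [norm_pairPoint_le g (latentPair m T q)]

/-- The weight absorbs the quadratic growth: ‖x‖² ≤ 2 exp ‖x‖ ≤ 2 exp(W‖x‖), where W ≥ 1 is needed.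
-/
theorem abs_momentStat_le (g : I → I) {W : ℝ} (hW : 1 ≤ W) {u v : EuclideanSpace ℝ (Fin d)}
    (hu : ‖u‖ = 1) (hv : ‖v‖ = 1)
    (q : (EuclideanSpace ℝ (Fin d) × ℝ) × (EuclideanSpace ℝ (Fin d) × ℝ) × I) :
    |momentStat g W u v q| ≤ 2 := by
  set x := pairPoint g q with hx
  have h1 : |(inner ℝ u x : ℝ)| ≤ ‖x‖ := by
    simpa [hu] using abs_real_inner_le_norm u x
  have h2 : |(inner ℝ v x : ℝ)| ≤ ‖x‖ := by
    simpa [hv] using abs_real_inner_le_norm v x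
  have h3 : ‖x‖ * ‖x‖ ≤ 2 * Real.exp (W * ‖x‖) := by
    have h4 := Real.quadratic_le_exp_of_nonneg (norm_nonneg x)
    have h5 : Real.exp ‖x‖ ≤ Real.exp (W * ‖x‖) :=
      Real.exp_le_exp.2 (le_mul_of_one_le_left (norm_nonneg x) hW)
    nlinarith [norm_nonneg x]
  rw [momentStat, ← hx, abs_mul, abs_mul, abs_of_pos (Real.exp_pos _), Real.exp_neg,
    inv_mul_le_iff₀ (Real.exp_pos _), mul_comm _ (2 : ℝ)]
  exact (mul_le_mul h1 h2 (abs_nonneg _) (norm_nonneg _)).trans h3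

/-- Labels drawn from the law satisfy |y| ≤ 1, so the half compensates 1 + |y|. That factor is kept
because it bounds |σ - y| for every real label, with no almost-sure restriction on the sample. -/
theorem abs_sizeStat_le (m : EuclideanSpace ℝ (Fin d))
    (T : EuclideanSpace ℝ (Fin d) →L[ℝ] EuclideanSpace ℝ (Fin d)) (q : LatentPair d) :
    |sizeStat (latentPair m T q)| ≤
      2 + (‖(latentPair m T q).1.1‖ + ‖(latentPair m T q).2.1.1‖) := by
  have h : |(latentPair m T q).1.2| ≤ 1 := by
    have h3 := abs_le.1 (abs_boolSign q.1.1).le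
    simp only [latentPair, latentPoint]
    rw [abs_le]; constructor <;> linarith
  have h0 := abs_nonneg (latentPair m T q).1.2
  have h1 := norm_nonneg (latentPair m T q).1.1
  have h2 := norm_nonneg (latentPair m T q).2.1.1
  rw [sizeStat, abs_of_nonneg (by positivity)]
  nlinarith

theorem sum_sum_eq_offDiag_add {n : ℕ} (a : Fin n → Fin n → ℝ) :
    ∑ i, ∑ j, a i j = ∑ i, ∑ j, (if i = j then 0 else a i j) + ∑ i, a i i := by
  rw [← Finset.sum_add_distrib]
  refine Finset.sum_congr rfl fun i _ => ?_
  have h : ∀ j, a i j = (if i = j then 0 else a i j) + (if i = j then a i j else 0) := fun j => by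
    split_ifs <;> simp
  rw [Finset.sum_congr rfl fun j _ => h j, Finset.sum_add_distrib]
  simp

theorem sum_sum_sum_rotate {α β γ : Type*} [Fintype α] [Fintype β] [Fintype γ]
    (f : α → β → γ → ℝ) : ∑ a, ∑ b, ∑ c, f a b c = ∑ c, ∑ a, ∑ b, f a b c :=
  (Finset.sum_congr rfl fun _ _ => Finset.sum_comm).trans Finset.sum_comm

theorem sum_offDiag_const {n : ℕ} (c : Fin n → ℝ) :
    ∑ i, ∑ j, (if i = j then 0 else c i) = ((n : ℝ) - 1) * ∑ i, c i := by
  have h := sum_sum_eq_offDiag_add fun i (_ : Fin n) => c i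
  simp only [Finset.sum_const, Finset.card_univ, Fintype.card_fin, nsmul_eq_mul,
    ← Finset.mul_sum] at h
  linarith

theorem offDiag_eq_centeredSum_add {n : ℕ} (m : EuclideanSpace ℝ (Fin d))
    (C : Matrix (Fin d) (Fin d) ℝ) (κ : ℝ) (L : Measure I)
    (h : (EuclideanSpace ℝ (Fin d) × ℝ) × (EuclideanSpace ℝ (Fin d) × ℝ) × I → ℝ)
    (ω : MixupSample d n) :
    ∑ i, ∑ j, (if i = j then 0 else h (ω.1 i, ω.1 j, ω.2 (i, j))) =
      centeredSum m C κ L h ω + ((n : ℝ) - 1) * n * ∫ q, h q ∂(pairLaw m C κ L) := by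
  have h1 := sum_offDiag_const fun _ : Fin n => ∫ q, h q ∂(pairLaw m C κ L)
  rw [Finset.sum_const, Finset.card_univ, Fintype.card_fin, nsmul_eq_mul, ← mul_assoc] at h1
  rw [← h1, centeredSum, ← Finset.sum_add_distrib]
  refine Finset.sum_congr rfl fun i _ => ?_
  rw [← Finset.sum_add_distrib]
  refine Finset.sum_congr rfl fun j _ => ?_
  split_ifs <;> simp

/-- The unmixed points have bounded average size. -/
theorem sum_sizeStat_diag_le {n : ℕ} (hn : 2 ≤ n) (m : EuclideanSpace ℝ (Fin d))
    (C : Matrix (Fin d) (Fin d) ℝ) (κ : ℝ) (L : Measure I) {B : ℝ}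
    (hB : |∫ q, sizeStat q ∂(pairLaw m C κ L)| ≤ B) (ω : MixupSample d n)
    (hω : |centeredSum m C κ L sizeStat ω| ≤ (n : ℝ) ^ 2) :
    ∑ i, ‖(ω.1 i).1‖ * (1 + |(ω.1 i).2|) ≤ 4 * n * (1 + B) := by
  have hn' : (2 : ℝ) ≤ n := by exact_mod_cast hn
  have h1 := offDiag_eq_centeredSum_add m C κ L sizeStat ω
  -- The statistic ignores the second point, so each i is counted n - 1 times: the off-diagonal
  -- bound controls a sum over single points.
  have h2 := sum_offDiag_const fun i => ‖(ω.1 i).1‖ * (1 + |(ω.1 i).2|) / 2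
  simp only [sizeStat] at h1 h2
  rw [h2, ← Finset.sum_div] at h1
  set S := ∑ i, ‖(ω.1 i).1‖ * (1 + |(ω.1 i).2|)
  have h3 := (abs_le.1 hω).2
  have h4 := (abs_le.1 hB).2
  simp only [sizeStat] at h3 h4
  have hS : 0 ≤ S := Finset.sum_nonneg fun i _ => by positivity
  have hB0 : 0 ≤ B := (abs_nonneg _).trans hB
  have h5 : ((n : ℝ) - 1) * n * ∫ q, ‖q.1.1‖ * (1 + |q.1.2|) / 2 ∂(pairLaw m C κ L) ≤
      ((n : ℝ) - 1) * n * B :=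
    mul_le_mul_of_nonneg_left h4 (mul_nonneg (by linarith) (by linarith))
  have h6 : ((n : ℝ) - 1) * (S / 2) ≤ (n : ℝ) ^ 2 + (n : ℝ) * n * B := by
    have : (n : ℝ) * B ≥ 0 := by positivity
    nlinarith
  have h7 : (n : ℝ) / 2 * (S / 2) ≤ ((n : ℝ) - 1) * (S / 2) :=
    mul_le_mul_of_nonneg_right (by linarith) (by linarith)
  have h8 : (n : ℝ) * S ≤ n * (4 * n * (1 + B)) := by nlinarith
  exact le_of_mul_le_mul_left h8 (by linarith)

/-- The off-diagonal part of each coordinate is already centered, hence at most ηn². The diagonal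
consists of unmixed points and is of order n, which the assumption on ηn absorbs into a second ηn².
-/
theorem norm_mixupGradient_le {n : ℕ} (hn : 2 ≤ n) {g : I → I} {m : EuclideanSpace ℝ (Fin d)}
    {C : Matrix (Fin d) (Fin d) ℝ} {κ : ℝ} {L : Measure I} {B η : ℝ}
    (hB : |∫ q, sizeStat q ∂(pairLaw m C κ L)| ≤ B) (ω : MixupSample d n)
    (hω : |centeredSum m C κ L sizeStat ω| ≤ (n : ℝ) ^ 2) (hη : 4 * (1 + B) ≤ η * n)
    {w : EuclideanSpace ℝ (Fin d)} (e : OrthonormalBasis (Fin d) ℝ (EuclideanSpace ℝ (Fin d)))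
    (hmean : ∀ a, ∫ q, gradientStat g w (e a) q ∂(pairLaw m C κ L) = 0)
    (hgrad : ∀ a, |centeredSum m C κ L (gradientStat g w (e a)) ω| ≤ η * (n : ℝ) ^ 2) :
    ‖mixupGradient g ω w‖ ≤ d * (2 * η) := by
  have hn' : (2 : ℝ) ≤ n := by exact_mod_cast hn
  have hcoord : ∀ a, |inner ℝ (e a) (mixupGradient g ω w)| ≤ 2 * η := by
    intro a
    rw [real_inner_comm, inner_mixupGradient]
    have h1 := offDiag_eq_centeredSum_add m C κ L (gradientStat g w (e a)) ω
    rw [hmean a, mul_zero, add_zero] at h1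
    rw [sum_sum_eq_offDiag_add]
    have h2 : |∑ i, (Real.sigmoid (inner ℝ w (mixedPoint g ω i i)) - mixedLabel ω i i) *
        inner ℝ (e a) (mixedPoint g ω i i)| ≤ 4 * n * (1 + B) := by
      refine (Finset.abs_sum_le_sum_abs _ _).trans ?_
      refine le_trans (Finset.sum_le_sum fun i _ => ?_) (sum_sizeStat_diag_le hn m C κ L hB ω hω)
      have e1 : mixedPoint g ω i i = (ω.1 i).1 := by rw [mixedPoint]; module
      have e2 : mixedLabel ω i i = (ω.1 i).2 := by rw [mixedLabel]; ring
      rw [e1, e2, abs_mul, mul_comm]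
      refine mul_le_mul ?_ ?_ (abs_nonneg _) (norm_nonneg _)
      · simpa using abs_real_inner_le_norm (e a) (ω.1 i).1
      · refine (abs_sub _ _).trans ?_
        rw [abs_of_nonneg (Real.sigmoid_nonneg _)]
        linarith [Real.sigmoid_le_one (inner ℝ w (ω.1 i).1)]
    have h3 := hgrad a
    rw [← h1] at h3
    simp only [gradientStat] at h3
    rw [abs_mul, abs_of_nonneg (by positivity), one_div, inv_mul_le_iff₀ (by positivity)]
    refine (abs_add_le _ _).trans ((add_le_add h3 h2).trans ?_)
    nlinarith
  have h := e.sum_repr' (mixupGradient g ω w)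
  rw [← h]
  refine (norm_sum_le _ _).trans ?_
  refine (Finset.sum_le_sum (g := fun _ => 2 * η) fun a _ => ?_).trans (by simp)
  rw [norm_smul, e.norm_eq_one, mul_one, Real.norm_eq_abs]
  exact hcoord a

/-- Expanding in a basis makes d² entries control all directions v at once. Nonnegative diagonal
terms are dropped; n(n - 1) ≥ n²/2 halves the mean, and the deviations cost another h₀/4. -/
theorem le_sum_exp_mul_sq_inner {n : ℕ} (hn : 2 ≤ n) {g : I → I}
    {m : EuclideanSpace ℝ (Fin d)} {C : Matrix (Fin d) (Fin d) ℝ} {κ : ℝ} {L : Measure I}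
    {W η h₀ : ℝ} (hh₀ : 0 ≤ h₀) (ω : MixupSample d n)
    (e : OrthonormalBasis (Fin d) ℝ (EuclideanSpace ℝ (Fin d)))
    (hint : ∀ a b, Integrable (momentStat g W (e a) (e b)) (pairLaw m C κ L))
    (hmean : ∀ v, h₀ * ‖v‖ ^ 2 ≤ ∫ q, momentStat g W v v q ∂(pairLaw m C κ L))
    (hη : η * d ^ 2 ≤ h₀ / 4)
    (hmom : ∀ a b, |centeredSum m C κ L (momentStat g W (e a) (e b)) ω| ≤ η * (n : ℝ) ^ 2)
    (v : EuclideanSpace ℝ (Fin d)) :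
    h₀ / 4 * ‖v‖ ^ 2 ≤ 1 / (n : ℝ) ^ 2 * ∑ i, ∑ j,
      Real.exp (-(W * ‖mixedPoint g ω i j‖)) * (inner ℝ v (mixedPoint g ω i j)) ^ 2 := by
  have hn' : (2 : ℝ) ≤ n := by exact_mod_cast hn
  have hexp : ∀ q, momentStat g W v v q = ∑ a, ∑ b, inner ℝ v (e a) * inner ℝ v (e b) *
      momentStat g W (e a) (e b) q := by
    intro q
    simp only [momentStat]
    nth_rewrite 1 [← e.sum_inner_mul_inner v (pairPoint g q)]
    rw [← e.sum_inner_mul_inner v (pairPoint g q), Finset.sum_mul_sum, Finset.mul_sum]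
    refine Finset.sum_congr rfl fun a _ => ?_
    rw [Finset.mul_sum]
    refine Finset.sum_congr rfl fun b _ => ?_
    ring
  have hmexp : ∫ q, momentStat g W v v q ∂(pairLaw m C κ L) = ∑ a, ∑ b,
      inner ℝ v (e a) * inner ℝ v (e b) *
        ∫ q, momentStat g W (e a) (e b) q ∂(pairLaw m C κ L) := by
    simp_rw [hexp]
    rw [integral_finsetSum _ fun a _ => integrable_finsetSum _ fun b _ =>
      (hint a b).const_mul _]
    refine Finset.sum_congr rfl fun a _ => ?_
    rw [integral_finsetSum _ fun b _ => (hint a b).const_mul _]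
    refine Finset.sum_congr rfl fun b _ => ?_
    rw [integral_const_mul]
  have hcexp : centeredSum m C κ L (momentStat g W v v) ω = ∑ a, ∑ b,
      inner ℝ v (e a) * inner ℝ v (e b) *
        centeredSum m C κ L (momentStat g W (e a) (e b)) ω := by
    have h1 : ∀ a b, centeredSum m C κ L (momentStat g W (e a) (e b)) ω =
        ∑ i, ∑ j, (if i = j then 0 else momentStat g W (e a) (e b) (ω.1 i, ω.1 j, ω.2 (i, j))) -
        ((n : ℝ) - 1) * n * ∫ q, momentStat g W (e a) (e b) q ∂(pairLaw m C κ L) := fun a b => by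
      rw [offDiag_eq_centeredSum_add m C κ L]; ring
    have h2 := offDiag_eq_centeredSum_add m C κ L (momentStat g W v v) ω
    have h3 : ∑ i, ∑ j, (if i = j then 0 else momentStat g W v v (ω.1 i, ω.1 j, ω.2 (i, j))) =
        ∑ a, ∑ b, inner ℝ v (e a) * inner ℝ v (e b) * ∑ i, ∑ j,
        (if i = j then 0 else momentStat g W (e a) (e b) (ω.1 i, ω.1 j, ω.2 (i, j))) := by
      simp_rw [Finset.mul_sum]
      rw [sum_sum_sum_rotate]
      refine Finset.sum_congr rfl fun i _ => ?_
      rw [sum_sum_sum_rotate]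
      refine Finset.sum_congr rfl fun j _ => ?_
      split_ifs
      · simp
      · exact hexp _
    simp_rw [h1, mul_sub, Finset.sum_sub_distrib]
    rw [← h3, h2, hmexp]
    simp_rw [Finset.mul_sum]
    rw [eq_sub_iff_add_eq]
    congr 1
    refine Finset.sum_congr rfl fun a _ => Finset.sum_congr rfl fun b _ => ?_
    ring
  have hcbound : -(η * (n : ℝ) ^ 2 * d ^ 2 * ‖v‖ ^ 2) ≤
      centeredSum m C κ L (momentStat g W v v) ω := by
    refine neg_le_of_abs_le ?_
    rw [hcexp]
    refine (Finset.abs_sum_le_sum_abs _ _).trans ?_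
    refine (Finset.sum_le_sum fun a _ => Finset.abs_sum_le_sum_abs _ _).trans ?_
    refine (Finset.sum_le_sum (g := fun _ => d * (‖v‖ * ‖v‖ * (η * (n : ℝ) ^ 2))) fun a _ => ?_).trans
      (le_of_eq ?_)
    · refine (Finset.sum_le_sum (g := fun _ => ‖v‖ * ‖v‖ * (η * (n : ℝ) ^ 2)) fun b _ => ?_).trans
        (by simp)
      have h1 : ∀ a, |(inner ℝ v (e a) : ℝ)| ≤ ‖v‖ := fun a => by
        simpa using abs_real_inner_le_norm v (e a)
      rw [abs_mul, abs_mul]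
      exact mul_le_mul (mul_le_mul (h1 a) (h1 b) (abs_nonneg _) (norm_nonneg _)) (hmom a b)
        (abs_nonneg _) (by positivity)
    · simp only [Finset.sum_const, Finset.card_univ, Fintype.card_fin, nsmul_eq_mul]
      ring
  have hdiag : ∑ i, ∑ j, (if i = j then 0 else momentStat g W v v (ω.1 i, ω.1 j, ω.2 (i, j))) ≤
      ∑ i, ∑ j, Real.exp (-(W * ‖mixedPoint g ω i j‖)) * (inner ℝ v (mixedPoint g ω i j)) ^ 2 := by
    refine Finset.sum_le_sum fun i _ => Finset.sum_le_sum fun j _ => ?_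
    split_ifs
    · positivity
    · rw [momentStat, sq]; rfl
  rw [offDiag_eq_centeredSum_add m C κ L] at hdiag
  have hm := mul_le_mul_of_nonneg_left (hmean v)
    (mul_nonneg (by linarith) (by linarith) : 0 ≤ ((n : ℝ) - 1) * n)
  rw [one_div, le_inv_mul_iff₀ (by positivity)]
  have h1 : (n : ℝ) ^ 2 / 2 * (h₀ * ‖v‖ ^ 2) ≤ ((n : ℝ) - 1) * n * (h₀ * ‖v‖ ^ 2) :=
    mul_le_mul_of_nonneg_right (by nlinarith) (by positivity)
  have h2 : (η * d ^ 2) * ((n : ℝ) ^ 2 * ‖v‖ ^ 2) ≤ h₀ / 4 * ((n : ℝ) ^ 2 * ‖v‖ ^ 2) :=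
    mul_le_mul_of_nonneg_right hη (by positivity)
  nlinarith

end

/-! ### Union bound, sample size and conclusion -/

instance {d : ℕ} (m : EuclideanSpace ℝ (Fin d)) (C : Matrix (Fin d) (Fin d) ℝ)
    (κ : ℝ) (L : Measure I) [IsProbabilityMeasure L] (n : ℕ) :
    IsProbabilityMeasure (mixupLaw m C κ L n) := by
  unfold mixupLaw; infer_instance

/-- The complement of finitely many unlikely events is likely. -/
theorem exists_measurableSet_of_tails {Ω ι : Type*} [MeasurableSpace Ω] [Fintype ι]
    (P : Measure Ω) [IsProbabilityMeasure P] {F : ι → Ω → ℝ} (hF : ∀ k, Measurable (F k))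
    {t p δ : ℝ} (hδ : 0 ≤ δ) (htail : ∀ k, P {ω | t ≤ |F k ω|} ≤ ENNReal.ofReal p)
    (hpδ : Fintype.card ι * p ≤ δ) :
    ∃ A : Set Ω, MeasurableSet A ∧ ENNReal.ofReal (1 - δ) ≤ P A ∧ ∀ ω ∈ A, ∀ k, |F k ω| ≤ t := by
  have hm : MeasurableSet (⋃ k, {ω | t ≤ |F k ω|}) :=
    MeasurableSet.iUnion fun k => measurableSet_le measurable_const
      (continuous_abs.measurable.comp (hF k))
  refine ⟨(⋃ k, {ω | t ≤ |F k ω|})ᶜ, hm.compl, ?_, fun ω hω k => ?_⟩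
  · rw [prob_compl_eq_one_sub hm, ENNReal.ofReal_sub _ hδ, ENNReal.ofReal_one]
    refine tsub_le_tsub_left ?_ _
    refine (measure_iUnion_fintype_le _ _).trans ((Finset.sum_le_sum fun k _ => htail k).trans ?_)
    rw [Finset.sum_const, nsmul_eq_mul, Finset.card_univ, ← ENNReal.ofReal_natCast,
      ← ENNReal.ofReal_mul (by positivity)]
    exact ENNReal.ofReal_le_ofReal hpδ
  · simp only [Set.mem_compl_iff, Set.mem_iUnion, Set.mem_ofPred_eq, not_exists, not_le] at hω
    exact (hω k).le

/-- A union bound over one size statistic, d gradient coordinates and d² moment entries. The point w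
is fixed before the sample is drawn, and the moments do not involve it. -/
theorem exists_uniform_concentration {d : ℕ} (m : EuclideanSpace ℝ (Fin d))
    {C : Matrix (Fin d) (Fin d) ℝ} (hC : C.PosDef) (L : Measure I) [IsProbabilityMeasure L]
    {g : I → I} (hg : Measurable g)
    (e : OrthonormalBasis (Fin d) ℝ (EuclideanSpace ℝ (Fin d))) {W : ℝ} (hW : 1 ≤ W) :
    ∃ B V : ℝ, 0 < B ∧ 1 ≤ V ∧ ∀ κ : ℝ, 1 ≤ κ → ∀ w : EuclideanSpace ℝ (Fin d),
      |∫ q, sizeStat q ∂(pairLaw m C κ L)| ≤ B ∧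
      (∀ a b, Integrable (momentStat g W (e a) (e b)) (pairLaw m C κ L)) ∧
      ∀ (n : ℕ) [NeZero n] (η δ : ℝ), 0 < η → η ≤ 1 → 0 < δ →
        Real.log (2 * (1 + d + d ^ 2)) + Real.log (1 / δ) ≤ n * η ^ 2 / (16 * V) →
        ∃ A : Set (MixupSample d n), MeasurableSet A ∧
          ENNReal.ofReal (1 - δ) ≤ mixupLaw m C κ L n A ∧ ∀ ω ∈ A,
          |centeredSum m C κ L sizeStat ω| ≤ η * (n : ℝ) ^ 2 ∧
          (∀ a, |centeredSum m C κ L (gradientStat g w (e a)) ω| ≤ η * (n : ℝ) ^ 2) ∧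
          ∀ a b, |centeredSum m C κ L (momentStat g W (e a) (e b)) ω| ≤ η * (n : ℝ) ^ 2 := by
  obtain ⟨B, V, hB, hV, H⟩ := exists_measure_abs_centeredSum_ge_le m hC L
  refine ⟨B, V, hB, hV, fun κ hκ w => ?_⟩
  have hsize := H κ hκ sizeStat measurable_sizeStat (abs_sizeStat_le m _)
  have hgrad := fun a => H κ hκ (gradientStat g w (e a)) (measurable_gradientStat hg _ _)
    (abs_gradientStat_le g m _ w (e.norm_eq_one a))
  have hmom := fun a b => H κ hκ (momentStat g W (e a) (e b)) (measurable_momentStat hg _ _ _)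
    (fun q => (abs_momentStat_le g hW (e.norm_eq_one a) (e.norm_eq_one b) _).trans
      (le_add_of_nonneg_right (by positivity)))
  refine ⟨hsize.1, fun a b => (hmom a b).2.1, fun n _ η δ hη hη1 hδ hn => ?_⟩
  let F : Option (Fin d ⊕ Fin d × Fin d) → MixupSample d n → ℝ := fun k =>
    k.elim (centeredSum m C κ L sizeStat) (Sum.elim
      (fun a => centeredSum m C κ L (gradientStat g w (e a)))
      (fun p => centeredSum m C κ L (momentStat g W (e p.1) (e p.2))))
  have hF : ∀ k, Measurable (F k) := by
    rintro (_ | a | p)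
    · exact measurable_centeredSum m C κ L measurable_sizeStat
    · exact measurable_centeredSum m C κ L (measurable_gradientStat hg _ _)
    · exact measurable_centeredSum m C κ L (measurable_momentStat hg _ _ _)
  have htail : ∀ k, mixupLaw m C κ L n {ω | η * (n : ℝ) ^ 2 ≤ |F k ω|} ≤
      ENNReal.ofReal (2 * Real.exp (-(n * η ^ 2 / (16 * V)))) := by
    rintro (_ | a | p)
    · exact hsize.2.2 n η hη hη1
    · exact (hgrad a).2.2 n η hη hη1
    · exact (hmom p.1 p.2).2.2 n η hη hη1
  obtain ⟨A, hA, hPA, hA'⟩ := exists_measurableSet_of_tails (mixupLaw m C κ L n) hF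
    hδ.le htail (by
      have hcard : (Fintype.card (Option (Fin d ⊕ Fin d × Fin d)) : ℝ) = 1 + d + d ^ 2 := by
        simp; ring
      rw [hcard]
      have h1 : Real.exp (-(n * η ^ 2 / (16 * V))) ≤
          Real.exp (-(Real.log (2 * (1 + d + d ^ 2)) + Real.log (1 / δ))) :=
        Real.exp_le_exp.2 (by linarith)
      rw [neg_add, Real.exp_add, Real.exp_neg (Real.log (2 * _)), Real.exp_log (by positivity), one_div, Real.log_inv,
        neg_neg, Real.exp_log hδ] at h1
      calc (1 + d + d ^ 2 : ℝ) * (2 * Real.exp (-(n * η ^ 2 / (16 * V))))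
          ≤ (1 + d + d ^ 2 : ℝ) * (2 * ((2 * (1 + d + d ^ 2 : ℝ))⁻¹ * δ)) := by gcongr
        _ = δ := by field_simp)
  exact ⟨A, hA, hPA, fun ω hω => ⟨hA' ω hω none, fun a => hA' ω hω (some (Sum.inl a)),
    fun a b => hA' ω hω (some (Sum.inr (a, b)))⟩⟩

/-- Consequences of the lower bound on the sample size. -/
theorem sample_size_bounds {η₀ B V l κ ε δ : ℝ} {n : ℕ} (hη₀ : 0 < η₀) (hB : 0 < B) (hV : 0 < V)
    (hl : 0 ≤ l) (hκ : 1 ≤ κ) (hε : 0 < ε) (hε1 : ε < 1) (hδ : 0 < δ) (hδ1 : δ < 1)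
    (hn : (2 + 4 * (1 + B) / η₀ + 16 * V / η₀ ^ 2 * (l + 1)) * κ ^ 2 / ε ^ 4 *
      (1 + Real.log (1 / ε) + Real.log (1 / δ)) ≤ (n : ℝ)) :
    2 ≤ n ∧ 4 * (1 + B) ≤ η₀ * ε / κ * n ∧
      l + Real.log (1 / δ) ≤ n * (η₀ * ε / κ) ^ 2 / (16 * V) := by
  have hκ0 : 0 < κ := by linarith
  have hlε : 0 ≤ Real.log (1 / ε) := Real.log_nonneg (by rw [le_div_iff₀ hε]; linarith)
  have hlδ : 0 ≤ Real.log (1 / δ) := Real.log_nonneg (by rw [le_div_iff₀ hδ]; linarith)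
  set X := 1 + Real.log (1 / ε) + Real.log (1 / δ) with hX
  have hX1 : 1 ≤ X := by rw [hX]; linarith
  have hr1 : 1 ≤ κ / ε := by rw [le_div_iff₀ hε]; linarith
  -- The argument needs only (κ/ε)²; the stated ε⁻⁴ is larger.
  have hr4 : (κ / ε) ^ 2 ≤ κ ^ 2 / ε ^ 4 := by
    rw [div_pow]
    refine div_le_div_of_nonneg_left (by positivity) (by positivity) ?_
    exact pow_le_pow_of_le_one hε.le hε1.le (by norm_num)
  set P := 4 * (1 + B) / η₀ with hP
  set Q := 16 * V / η₀ ^ 2 * (l + 1) with hQ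
  have hP0 : 0 ≤ P := by positivity
  have hQ0 : 0 ≤ Q := by positivity
  set Y := (κ / ε) ^ 2 * X with hY
  have hY1 : 1 ≤ Y := one_le_mul_of_one_le_of_one_le (one_le_pow₀ hr1) hX1
  have hYr : κ / ε ≤ Y := by
    have : κ / ε ≤ (κ / ε) ^ 2 := le_self_pow₀ hr1 two_ne_zero
    exact this.trans (le_mul_of_one_le_right (by positivity) hX1)
  -- The three summands of the constant pay for the three conclusions, in order.
  have hn' : 2 * Y + P * Y + Q * Y ≤ n := by
    have h1 : (2 + P + Q) * Y ≤ (2 + P + Q) * (κ ^ 2 / ε ^ 4 * X) :=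
      mul_le_mul_of_nonneg_left (mul_le_mul_of_nonneg_right hr4 (by linarith)) (by linarith)
    have h2 : (2 + P + Q) * (κ ^ 2 / ε ^ 4 * X) = (2 + P + Q) * κ ^ 2 / ε ^ 4 * X := by ring
    linarith
  have hPY : 0 ≤ P * Y := mul_nonneg hP0 (by linarith)
  have hQY : 0 ≤ Q * Y := mul_nonneg hQ0 (by linarith)
  refine ⟨?_, ?_, ?_⟩
  · have : (2 : ℝ) ≤ n := by linarith
    exact_mod_cast this
  · have h1 : P * (κ / ε) ≤ n := by linarith [mul_le_mul_of_nonneg_left hYr hP0]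
    calc 4 * (1 + B) = η₀ * ε / κ * (P * (κ / ε)) := by rw [hP]; field_simp
      _ ≤ _ := mul_le_mul_of_nonneg_left h1 (by positivity)
  · have h1 : Q * Y ≤ n := by linarith
    have h2 : l + Real.log (1 / δ) ≤ (l + 1) * X := by
      have : l ≤ l * X := le_mul_of_one_le_right hl hX1
      rw [add_mul, one_mul]
      linarith
    calc l + Real.log (1 / δ) ≤ (l + 1) * X := h2
      _ = Q * Y * (η₀ * ε / κ) ^ 2 / (16 * V) := by rw [hQ, hY]; field_simp
      _ ≤ _ := by gcongr

theorem theorem5 {d : ℕ} (μ : EuclideanSpace ℝ (Fin d)) (C : Matrix (Fin d) (Fin d) ℝ)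
    (hμ : μ ≠ 0) (hC : C.PosDef) (hμC : ‖μ‖ ^ 2 = ‖Matrix.toEuclideanCLM (𝕜 := ℝ) C‖)
    (L : Measure unitInterval) [IsProbabilityMeasure L]
    (g : unitInterval → unitInterval) (hg_meas : Measurable g)
    (hg : ∀ z : unitInterval, 1 / 2 < (g z : ℝ) ↔ 1 / 2 < (z : ℝ))
    (hL : 0 < L {z : unitInterval | z ≠ 0 ∧ z ≠ 1 ∧ (g z : ℝ) ≠ 1 / 2}) :
    ∃ K : ℝ, 0 < K ∧ ∃ κ₀ : ℝ, 0 < κ₀ ∧ ∀ κ : ℝ, κ₀ ≤ κ →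
      ∀ ε δ : ℝ, 0 < ε → ε < 1 → 0 < δ → δ < 1 →
      ∀ n : ℕ, K * κ ^ 2 / ε ^ 4 * (1 + Real.log (1 / ε) + Real.log (1 / δ)) ≤ (n : ℝ) →
        ∃ A : Set (MixupSample d n), MeasurableSet A ∧
          ENNReal.ofReal (1 - δ) ≤ mixupLaw μ C κ L n A ∧
          ∀ ω ∈ A, ∃ w : EuclideanSpace ℝ (Fin d),
            IsUniqueMinimizer (mixupLoss g ω) w ∧ w ≠ 0 ∧
            1 - ε ≤ cosSim w (Matrix.toEuclideanCLM (𝕜 := ℝ) C⁻¹ μ) := by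
  set θ := Matrix.toEuclideanCLM (𝕜 := ℝ) C⁻¹ μ with hθdef
  have hCθ : Matrix.toEuclideanCLM (𝕜 := ℝ) C θ = μ := toEuclideanCLM_mul_inv hC μ
  have hθ : θ ≠ 0 := fun h => hμ (by rw [← hCθ, h, map_zero])
  have hθ0 : 0 < ‖θ‖ := norm_pos_iff.2 hθ
  obtain ⟨s, hs, hsT⟩ := exists_le_norm_sq_noiseMap hC
  have hpos : 0 < (inner ℝ θ μ : ℝ) := by
    have h1 := inner_noiseMap_noiseMap hC one_pos θ θ
    rw [hCθ, inv_one, one_mul, real_inner_self_eq_norm_sq] at h1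
    rw [← h1]
    refine lt_of_lt_of_le ?_ (hsT 1 one_pos θ)
    positivity
  obtain ⟨lo, hi, hlo, hlohi, hrad⟩ := exists_radialGradient_eq_zero hg_meas μ θ hpos hg hL
    ‖noiseMap C 1‖
  have hhi : 0 < hi := hlo.trans_le hlohi
  -- Points within ε c‖θ‖/2 of cθ have norm at most 2 hi‖θ‖; the extra 1 gives the W ≥ 1 that bounds
  -- the moment entries.
  set W := 2 * (hi * ‖θ‖) + 1 with hWdef
  have hW1 : 1 ≤ W := by rw [hWdef]; linarith [mul_pos hhi hθ0]
  obtain ⟨cq, hcq, hmoment⟩ := exists_le_integral_exp_mul_sq_inner L hg_meas μ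
    (τ := ‖noiseMap C 1‖) (W := W) (by linarith)
  let e := EuclideanSpace.basisFun (Fin d) ℝ
  obtain ⟨B, V, hB, hV, hconc⟩ := exists_uniform_concentration μ hC L hg_meas e hW1
  have hd : 0 < (d : ℝ) := by
    rcases Nat.eq_zero_or_pos d with h | h
    · subst h; exact absurd (Subsingleton.elim μ 0) hμ
    · exact_mod_cast h
  set b := cq * s with hb
  have hb0 : 0 < b := by positivity
  -- In order: the range of the tail bound, deviations of the moment matrix below a quarter of its
  -- mean, and a gradient below curvature times radius. Every c in question is at least lo, so η₀
  -- does not depend on κ.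
  set η₀ := min 1 (min (b / (4 * d ^ 2)) (b * (lo * ‖θ‖) / (256 * d))) with hη₀
  have hη₀0 : 0 < η₀ := by positivity
  have hη₀1 : η₀ ≤ 1 := min_le_left _ _
  have hη₀2 : η₀ ≤ b / (4 * d ^ 2) := (min_le_right _ _).trans (min_le_left _ _)
  have hη₀3 : η₀ ≤ b * (lo * ‖θ‖) / (256 * d) := (min_le_right _ _).trans (min_le_right _ _)
  set ℓ := Real.log (2 * (1 + d + d ^ 2)) with hℓ
  have hℓ0 : 0 ≤ ℓ := Real.log_nonneg (by nlinarith)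
  refine ⟨2 + 4 * (1 + B) / η₀ + 16 * V / η₀ ^ 2 * (ℓ + 1), by positivity, 1, one_pos,
    fun κ hκ ε δ hε hε1 hδ hδ1 n hn => ?_⟩
  have hκ0 : 0 < κ := by linarith
  -- Curvature is of order 1/κ and the radius of order ε, so the gradient must be resolved to their
  -- product.
  set η := η₀ * ε / κ with hη
  have hη0 : 0 < η := by positivity
  have hηη₀ : η ≤ η₀ := by
    rw [hη, div_le_iff₀ hκ0]
    exact mul_le_mul_of_nonneg_left (by linarith) hη₀0.le
  obtain ⟨hn2, hnB, hnlog⟩ := sample_size_bounds hη₀0 hB (by linarith) hℓ0 hκ hε hε1 hδ hδ1 hn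
  have : NeZero n := ⟨by omega⟩
  have hTτ := norm_noiseMap_le hC hκ
  obtain ⟨c, hc1, hc2, hc0⟩ := hrad (noiseMap C κ) (inner_noiseMap C κ) hTτ
  have hcpos : 0 < c := hlo.trans_le hc1
  obtain ⟨hsizeB, hint, hA⟩ := hconc κ hκ (c • θ)
  obtain ⟨A, hAm, hAP, hAω⟩ := hA n η δ hη0 (hηη₀.trans hη₀1) hδ hnlog
  refine ⟨A, hAm, hAP, fun ω hω => ?_⟩
  obtain ⟨hω1, hω2, hω3⟩ := hAω ω hω
  have hgradnorm : ‖mixupGradient g ω (c • θ)‖ ≤ d * (2 * η) :=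
    norm_mixupGradient_le hn2 hsizeB ω
      (hω1.trans (mul_le_of_le_one_left (sq_nonneg _) (hηη₀.trans hη₀1))) hnB e
      (fun a => integral_gradient_eq_zero hg_meas hC hκ0 hCθ hpos hc0 (e a)) hω2
  have hmean : ∀ v, b / κ * ‖v‖ ^ 2 ≤ ∫ q, momentStat g W v v q ∂(pairLaw μ C κ L) := by
    intro v
    have h1 := hmoment (noiseMap C κ) (inner_noiseMap C κ) hTτ v
    rw [integral_pairLaw μ C κ L (measurable_momentStat hg_meas W v v)]
    simp only [momentStat, ← sq]
    refine le_trans ?_ h1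
    calc b / κ * ‖v‖ ^ 2 = cq * (s / κ * ‖v‖ ^ 2) := by rw [hb]; ring
      _ ≤ _ := mul_le_mul_of_nonneg_left (hsT κ hκ0 v) hcq.le
  have hηd : η * d ^ 2 ≤ b / κ / 4 := by
    have h1 : η₀ * (4 * d ^ 2) ≤ b := by rwa [le_div_iff₀ (by positivity)] at hη₀2
    rw [hη, div_mul_eq_mul_div, div_div, div_le_div_iff₀ hκ0 (by positivity)]
    have h2 : η₀ * ε * (4 * d ^ 2) ≤ b := by
      refine le_trans ?_ h1
      have : η₀ * ε ≤ η₀ := mul_le_of_le_one_right hη₀0.le hε1.le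
      gcongr
    nlinarith
  have hmomω := le_sum_exp_mul_sq_inner hn2 (by positivity) ω e hint hmean hηd hω3
  set r := ε / 2 * (c * ‖θ‖) with hr
  have hr0 : 0 < r := by positivity
  have hball : ∀ w ∈ Metric.closedBall (c • θ) r, ‖w‖ ≤ W := by
    intro w hw
    rw [mem_closedBall_iff_norm] at hw
    have h1 := norm_add_le (w - c • θ) (c • θ)
    rw [sub_add_cancel, norm_smul, Real.norm_of_nonneg hcpos.le] at h1
    have h2 : c * ‖θ‖ ≤ hi * ‖θ‖ := by gcongr
    have h3 : r ≤ c * ‖θ‖ := by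
      rw [hr]; exact mul_le_of_le_one_left (by positivity) (by linarith)
    rw [hWdef]
    linarith
  -- The 32 combines the 1/8 of the quadratic tangent bound with the quarter of b/κ left after
  -- sampling. The choice of η₀ makes the gradient at most half of the right side.
  have hsmall : ‖mixupGradient g ω (c • θ)‖ < b / κ / 32 * r := by
    refine hgradnorm.trans_lt ?_
    have h1 : η₀ * (256 * d) ≤ b * (lo * ‖θ‖) := by
      rwa [le_div_iff₀ (by positivity)] at hη₀3
    have h2 : b * (lo * ‖θ‖) ≤ b * (c * ‖θ‖) := by gcongr
    have h3 : d * (2 * η) = (ε / κ) * (η₀ * (256 * d)) / 128 := by rw [hη]; ring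
    have h4 : b / κ / 32 * r = (ε / κ) * (b * (c * ‖θ‖)) / 64 := by rw [hr]; ring
    rw [h3, h4]
    have h5 := mul_le_mul_of_nonneg_left (h1.trans h2) (show 0 ≤ ε / κ by positivity)
    have h6 : 0 < ε / κ * (b * (c * ‖θ‖)) := by positivity
    linarith
  obtain ⟨w, hw, hwr⟩ := exists_isUniqueMinimizer_of_small_gradient (f := mixupLoss g ω)
    (G := mixupGradient g ω) hr0 (show 0 < b / κ / 32 by positivity) (continuous_mixupLoss g ω)
    (mixupLoss_tangent_le g ω) (fun w hw v hv => by
      refine le_trans ?_ (mixupLoss_strong_tangent_le g ω (hball w hw) (hball v hv))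
      have := hmomω (v - w)
      linarith) hsmall
  obtain ⟨hw0, hcos⟩ := le_cosSim_of_norm_sub_le hcpos hθ hε hε1 hwr
  exact ⟨w, hw, hw0, hcos⟩
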